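/- Let $r,s\ge 0$ be integers, let $\varrho>0$, and let $\varepsilon,\delta\in\{1,-1\}$. Let $\mathbb{R}^{(r,s)}$ be $\mathbb{R}^{r+s}$ with the inner product $(v,w)=-\sum_{i\le r}v_iw_i+\sum_{j\le s}v_{r+j}w_{r+j}$, and let $$S=S^{\delta}(r,s;\varrho)=\{v\in\mathbb{R}^{(r,s)}:(v,v)=\delta\varrho^{-2}\}$$ be the pseudo-sphere with its induced pseudo-Riemannian metric $ds_S^2$. Let $\kappa=\delta\varrho^2$, which is the constant sectional curvature of $S$; if $\dim S=r+s-1\le 1$, where sectional curvature carries no information, $\kappa$ may be any real number. Let $A,B\in\mathbb{R}$ satisfy $A^2-4\varepsilon\kappa B\ne0$, put $f(t)=\varepsilon\kappa t^2+At+B$, and let $I\subset\mathbb{R}$ be an open interval on which $f$ does not vanish. On $M=I\times S$ consider $$g_M=\varepsilon\,dt^2+f(t)\,ds_S^2,\qquad C(t)=f(t)^{-2}\left\{f(t)\kappa-\tfrac14\varepsilon f'(t)^2\right\},$$ and let $\phi$ be the endomorphism of $TM$ with $\phi(\partial_t)=\partial_t$ and $\phi=-\mathrm{id}$ on $TS$.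 Then $(M,g_M)$ is a pseudo-Riemannian manifold (that is, $g_M$ is smooth, symmetric and nondegenerate). It has a Levi-Civita connection $\nabla$, and the curvature operator $R(x,y)=\nabla_x\nabla_y-\nabla_y\nabla_x-\nabla_{[x,y]}$ is $$R(x,y)z=C(t)\,\bigl\{g_M(\phi y,z)\,\phi x-g_M(\phi x,z)\,\phi y\bigr\}$$ at every point $(t,p)\in M$, for all tangent vectors $x,y,z$ there. Moreover $(M,g_M)$ is spacelike, timelike and mixed rank $2$ Jordan IP. That is, for an oriented nondegenerate tangent $2$-plane $\pi$ with oriented basis $(e_1,e_2)$ put $$R(\pi)=\left|g_M(e_1,e_1)g_M(e_2,e_2)-g_M(e_1,e_2)^2\right|^{-1/2}R(e_1,e_2).$$ Then at each point $P\in M$ and for each of the three types of $2$-planes in $T_PM$ (spacelike: $g_M|_\pi$ is positive definite; timelike: $g_M|_\pi$ is negative definite; mixed: $g_M|_\pi$ has signature $(1,1)$), the operators $R(\pi)$, over all oriented $2$-planes $\pi\subset T_PM$ of that type, all have rank $2$ and are all conjugate to each other in $\mathrm{End}(T_PM)$. -/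

import Mathlib

open scoped Manifold ContDiff Topology

noncomputable section

/-! ### Algebra: curvature tensors on a vector space with an indefinite inner product -/

namespace CurvatureAlgebra

variable {V : Type*} [AddCommGroup V] [Module ℝ V]

/-- The operator `R_φ(x,y)z = (φ y, z) φ x - (φ x, z) φ y`, for the inner product `g` and the
linear map `φ`. -/
def RTensor (g : V → V → ℝ) (φ : V →ₗ[ℝ] V) (x y z : V) : V :=
  g (φ y) z • φ x - g (φ x) z • φ y

/-- `(e₁, e₂)` is an oriented basis of a spacelike `2`-plane (induced metric of signature
`(0,2)`). -/
def SpacelikePlane (g : V → V → ℝ) (e₁ e₂ : V) : Prop :=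
  LinearIndependent ℝ ![e₁, e₂] ∧ ∀ v ∈ Submodule.span ℝ {e₁, e₂}, v ≠ 0 → 0 < g v v

/-- `(e₁, e₂)` is an oriented basis of a timelike `2`-plane (induced metric of signature
`(2,0)`). -/
def TimelikePlane (g : V → V → ℝ) (e₁ e₂ : V) : Prop :=
  LinearIndependent ℝ ![e₁, e₂] ∧ ∀ v ∈ Submodule.span ℝ {e₁, e₂}, v ≠ 0 → g v v < 0

/-- `(e₁, e₂)` is an oriented basis of a mixed `2`-plane (induced metric of signature `(1,1)`,
i.e. the plane contains both a timelike and a spacelike vector). -/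
def MixedPlane (g : V → V → ℝ) (e₁ e₂ : V) : Prop :=
  LinearIndependent ℝ ![e₁, e₂] ∧
    (∃ v ∈ Submodule.span ℝ {e₁, e₂}, g v v < 0) ∧ ∃ v ∈ Submodule.span ℝ {e₁, e₂}, 0 < g v v

/-- The skew-symmetric curvature operator
`R(π) = |(e₁,e₁)(e₂,e₂) - (e₁,e₂)²|^{-1/2} R(e₁,e₂)` of the oriented plane `π` with oriented
basis `(e₁, e₂)`. -/
def skewCurvatureOperator (g : V → V → ℝ) (R : V → V → V →ₗ[ℝ] V) (e₁ e₂ : V) : V →ₗ[ℝ] V :=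
  (√|g e₁ e₁ * g e₂ e₂ - g e₁ e₂ ^ 2|)⁻¹ • R e₁ e₂

/-- Two linear maps are Jordan equivalent if they are conjugate by a linear automorphism. -/
def JordanEquivalent (T T' : V →ₗ[ℝ] V) : Prop :=
  ∃ Θ : V ≃ₗ[ℝ] V, T = Θ.toLinearMap ∘ₗ T' ∘ₗ Θ.symm.toLinearMap

/-- `R` is rank `r` Jordan IP on the class `P` of oriented `2`-planes: on the planes of that class
`R(π)` has rank `r` and a constant Jordan normal form. -/
def IsRankJordanIP (g : V → V → ℝ) (P : V → V → Prop) (r : ℕ) (R : V → V → V →ₗ[ℝ] V) : Prop :=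
  (∀ e₁ e₂ : V, P e₁ e₂ →
    Module.finrank ℝ (LinearMap.range (skewCurvatureOperator g R e₁ e₂)) = r) ∧
  ∀ e₁ e₂ e₁' e₂' : V, P e₁ e₂ → P e₁' e₂' →
    JordanEquivalent (skewCurvatureOperator g R e₁ e₂) (skewCurvatureOperator g R e₁' e₂')

end CurvatureAlgebra

/-! ### Geometry: pseudo-Riemannian metrics, Levi-Civita connections, curvature -/

namespace PseudoRiemannian

variable {E : Type*} [NormedAddCommGroup E] [NormedSpace ℝ E]
  {H : Type*} [TopologicalSpace H] (I : ModelWithCorners ℝ E H)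
  {M : Type*} [TopologicalSpace M] [ChartedSpace H M]

/-- The bilinear form `(u, v) ↦ b (L u) (L v)`. -/
def pullback {V W : Type*} [AddCommGroup V] [Module ℝ V] [TopologicalSpace V]
    [IsTopologicalAddGroup V] [ContinuousSMul ℝ V] [AddCommGroup W] [Module ℝ W]
    [TopologicalSpace W] [IsTopologicalAddGroup W] [ContinuousSMul ℝ W]
    (b : W →L[ℝ] W →L[ℝ] ℝ) (L : V →L[ℝ] W) : V →L[ℝ] V →L[ℝ] ℝ :=
  (ContinuousLinearMap.precomp ℝ L) ∘L b ∘L L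

/-- A field of bilinear forms on the tangent spaces of `M`. -/
abbrev FormField (I : ModelWithCorners ℝ E H) (M : Type*) [TopologicalSpace M]
    [ChartedSpace H M] : Type _ :=
  ∀ x : M, TangentSpace I x →L[ℝ] TangentSpace I x →L[ℝ] ℝ

/-- A vector field on `M` (no regularity required). -/
abbrev VectField (I : ModelWithCorners ℝ E H) (M : Type*) [TopologicalSpace M]
    [ChartedSpace H M] : Type _ :=
  ∀ x : M, TangentSpace I x

/-- `(M, g)` is a pseudo-Riemannian manifold: `g` is smooth, symmetric and nondegenerate. -/
structure IsMetric [IsManifold I ∞ M] (g : FormField I M) : Prop where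
  smooth : ContMDiff I (I.prod 𝓘(ℝ, E →L[ℝ] E →L[ℝ] ℝ)) ∞
    (fun x ↦ Bundle.TotalSpace.mk' (E →L[ℝ] E →L[ℝ] ℝ)
      (E := fun x : M ↦ TangentSpace I x →L[ℝ] TangentSpace I x →L[ℝ] ℝ) x (g x))
  symm : ∀ (x : M) (u v : TangentSpace I x), g x u v = g x v u
  nondegenerate : ∀ (x : M) (u : TangentSpace I x), (∀ v, g x u v = 0) → u = 0

variable [IsManifold I ∞ M] [FiniteDimensional ℝ E]

/-- `cov` is a Levi-Civita connection of `g`: it is torsion free and compatible with `g`.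
Recall that `cov Y x u` is `(∇_u Y)(x)`. -/
def IsLeviCivita (g : FormField I M)
    (cov : CovariantDerivative I E (TangentSpace I : M → Type _)) : Prop :=
  (∀ (x : M) (X Y : VectField I M),
    MDifferentiableAt I I.tangent (fun y ↦ (⟨y, X y⟩ : TangentBundle I M)) x →
    MDifferentiableAt I I.tangent (fun y ↦ (⟨y, Y y⟩ : TangentBundle I M)) x →
    cov Y x (X x) - cov X x (Y x) = VectorField.mlieBracket I X Y x) ∧
  ∀ (x : M) (Y Z : VectField I M),
    MDifferentiableAt I I.tangent (fun y ↦ (⟨y, Y y⟩ : TangentBundle I M)) x →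
    MDifferentiableAt I I.tangent (fun y ↦ (⟨y, Z y⟩ : TangentBundle I M)) x →
    ∀ u : TangentSpace I x,
      mvfderiv I (fun y ↦ g y (Y y) (Z y)) x u = g x (cov Y x u) (Z x) + g x (Y x) (cov Z x u)

/-- The vector field `∇_X ∇_Y Z - ∇_Y ∇_X Z - ∇_{[X,Y]} Z`. -/
def curvatureField (cov : CovariantDerivative I E (TangentSpace I : M → Type _))
    (X Y Z : VectField I M) : VectField I M := fun x ↦
  cov (fun y ↦ cov Z y (Y y)) x (X x) - cov (fun y ↦ cov Z y (X y)) x (Y x)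
    - cov Z x (VectorField.mlieBracket I X Y x)

/-- The type of tensor fields `R` for which `R x u v` is an endomorphism of `T_x M`, for
`u, v ∈ T_x M`. -/
abbrev CurvField (I : ModelWithCorners ℝ E H) (M : Type*) [TopologicalSpace M]
    [ChartedSpace H M] : Type _ :=
  ∀ x : M, TangentSpace I x →ₗ[ℝ] TangentSpace I x →ₗ[ℝ] TangentSpace I x →ₗ[ℝ] TangentSpace I x

/-- `R` is the Riemann curvature operator of `g`: the Levi-Civita connection of `g` exists, and
`R(X,Y)Z = ∇_X ∇_Y Z - ∇_Y ∇_X Z - ∇_{[X,Y]} Z` at each `x` for all vector fields `X, Y, Z` that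
are smooth near `x`. (As each tangent vector extends to such a field, `R` is unique.) -/
def IsRiemannCurvature (g : FormField I M) (R : CurvField I M) : Prop :=
  (∃ cov, IsLeviCivita I g cov) ∧
  ∀ cov, IsLeviCivita I g cov → ∀ (x : M) (X Y Z : VectField I M),
    ContMDiffAt I I.tangent ∞ (fun y ↦ (⟨y, X y⟩ : TangentBundle I M)) x →
    ContMDiffAt I I.tangent ∞ (fun y ↦ (⟨y, Y y⟩ : TangentBundle I M)) x →
    ContMDiffAt I I.tangent ∞ (fun y ↦ (⟨y, Z y⟩ : TangentBundle I M)) x →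
    curvatureField I cov X Y Z x = R x (X x) (Y x) (Z x)

open CurvatureAlgebra

/-- `(M, g)` is spacelike rank `r` Jordan IP: its curvature is so at each point (the Jordan form
may vary with the point, the rank may not). -/
def IsSpacelikeRankJordanIP (g : FormField I M) (r : ℕ) : Prop :=
  ∃ R : CurvField I M, IsRiemannCurvature I g R ∧ ∀ x : M,
    IsRankJordanIP (fun u v ↦ g x u v) (SpacelikePlane fun u v ↦ g x u v) r (fun u v ↦ R x u v)

/-- `(M, g)` is timelike rank `r` Jordan IP. -/
def IsTimelikeRankJordanIP (g : FormField I M) (r : ℕ) : Prop :=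
  ∃ R : CurvField I M, IsRiemannCurvature I g R ∧ ∀ x : M,
    IsRankJordanIP (fun u v ↦ g x u v) (TimelikePlane fun u v ↦ g x u v) r (fun u v ↦ R x u v)

/-- `(M, g)` is mixed rank `r` Jordan IP. -/
def IsMixedRankJordanIP (g : FormField I M) (r : ℕ) : Prop :=
  ∃ R : CurvField I M, IsRiemannCurvature I g R ∧ ∀ x : M,
    IsRankJordanIP (fun u v ↦ g x u v) (MixedPlane fun u v ↦ g x u v) r (fun u v ↦ R x u v)

end PseudoRiemannian

/-! ### The pseudo-spheres as smooth manifolds -/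

namespace PseudoSphere

/-- The vector space `ℝ^{r+s}` on which the inner product of signature `(r,s)` lives. -/
abbrev Ambient (r s : ℕ) : Type := Fin r ⊕ Fin s → ℝ

/-- The standard inner product of signature `(r,s)`: `r` timelike (negative) and `s` spacelike
(positive) directions. -/
def form (r s : ℕ) : Ambient r s →L[ℝ] Ambient r s →L[ℝ] ℝ :=
  - ∑ i : Fin r, (ContinuousLinearMap.proj (R := ℝ) (φ := fun _ ↦ ℝ) (Sum.inl i)).smulRight
        (ContinuousLinearMap.proj (R := ℝ) (φ := fun _ : Fin r ⊕ Fin s ↦ ℝ) (Sum.inl i))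
    + ∑ j : Fin s, (ContinuousLinearMap.proj (R := ℝ) (φ := fun _ ↦ ℝ) (Sum.inr j)).smulRight
        (ContinuousLinearMap.proj (R := ℝ) (φ := fun _ : Fin r ⊕ Fin s ↦ ℝ) (Sum.inr j))

theorem form_apply (r s : ℕ) (v w : Ambient r s) :
    form r s v w = - ∑ i : Fin r, v (Sum.inl i) * w (Sum.inl i)
      + ∑ j : Fin s, v (Sum.inr j) * w (Sum.inr j) := by
  simp [form]

theorem form_symm (r s : ℕ) (v w : Ambient r s) : form r s v w = form r s w v := by
  simp only [form_apply, mul_comm]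

/-- The sign `±1` as a real number. -/
abbrev sgn (δ : ℤˣ) : ℝ := ((δ : ℤ) : ℝ)

/-- The pseudo-sphere `S^δ(r,s;ϱ) = {v : (v,v) = δ ϱ⁻²}`. -/
def pseudosphere (r s : ℕ) (δ : ℤˣ) (ϱ : ℝ) : Set (Ambient r s) :=
  {v | form r s v v = sgn δ * (ϱ ^ 2)⁻¹}

variable {r s : ℕ} {δ : ℤˣ} {ϱ : ℝ}

theorem form_self_ne_zero [hϱ : Fact (0 < ϱ)] (p : pseudosphere r s δ ϱ) :
    form r s p p ≠ 0 := by
  have h : form r s p p = sgn δ * (ϱ ^ 2)⁻¹ := p.2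
  have := hϱ.out
  rw [h]
  refine mul_ne_zero ?_ (by positivity)
  exact Int.cast_ne_zero.2 δ.ne_zero

theorem form_self_eq (p q : pseudosphere r s δ ϱ) : form r s p p = form r s q q :=
  p.2.trans q.2.symm

/-- The orthogonal complement of `p`; geometrically the tangent space of the pseudo-sphere
at `p`. -/
abbrev perp (p : Ambient r s) : Submodule ℝ (Ambient r s) :=
  LinearMap.ker (form r s p).toLinearMap

theorem finrank_perp [Fact (0 < ϱ)] (p : pseudosphere r s δ ϱ) :
    Module.finrank ℝ (perp (p : Ambient r s)) =
      Module.finrank ℝ (EuclideanSpace ℝ (Fin (r + s - 1))) := by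
  have h := LinearMap.finrank_range_add_finrank_ker (form r s (p : Ambient r s)).toLinearMap
  have hr : LinearMap.range (form r s (p : Ambient r s)).toLinearMap = ⊤ := by
    apply LinearMap.range_eq_top.2
    apply LinearMap.surjective
    intro h0
    exact form_self_ne_zero p (by simpa using congrArg (fun l ↦ l (p : Ambient r s)) h0)
  rw [hr] at h
  simp at h
  simp only [finrank_euclideanSpace, Fintype.card_fin]
  change Module.finrank ℝ (LinearMap.ker (form r s (p : Ambient r s)).toLinearMap) = _
  omega

/-- A linear identification of the orthogonal complement of `p` with the model space. -/
def perpEquiv [Fact (0 < ϱ)] (p : pseudosphere r s δ ϱ) :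
    perp (p : Ambient r s) ≃L[ℝ] EuclideanSpace ℝ (Fin (r + s - 1)) :=
  ContinuousLinearEquiv.ofFinrankEq (finrank_perp p)

/-- Orthogonal projection onto the orthogonal complement of `p`. -/
def perpProj [Fact (0 < ϱ)] (p : pseudosphere r s δ ϱ) :
    Ambient r s →L[ℝ] perp (p : Ambient r s) :=
  (ContinuousLinearMap.id ℝ (Ambient r s)
      - ((form r s p p)⁻¹ • form r s p).smulRight (p : Ambient r s)).codRestrict _ (by
    intro v
    have := form_self_ne_zero p
    simp
    field_simp
    ring)

theorem perpProj_coe [Fact (0 < ϱ)] (p : pseudosphere r s δ ϱ) (v : Ambient r s) :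
    (perpProj p v : Ambient r s) =
      v - ((form r s p p)⁻¹ * form r s p v) • (p : Ambient r s) := by
  simp [perpProj]

/-- The height `√(1 - (w,w)/(p,p))` of the pseudo-sphere over the point `w` of the orthogonal
complement of `p`. -/
def height [Fact (0 < ϱ)] (p : pseudosphere r s δ ϱ) (w : Ambient r s) : ℝ :=
  √(1 - (form r s p p)⁻¹ * form r s w w)

/-- The point `height(w) p + w` of the ambient space. -/
def lift [Fact (0 < ϱ)] (p : pseudosphere r s δ ϱ) (y : EuclideanSpace ℝ (Fin (r + s - 1))) :
    Ambient r s :=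
  height p ((perpEquiv p).symm y : Ambient r s) • (p : Ambient r s)
    + ((perpEquiv p).symm y : Ambient r s)

theorem form_perp [Fact (0 < ϱ)] (p : pseudosphere r s δ ϱ) (w : perp (p : Ambient r s)) :
    form r s p w = 0 := w.2

theorem lift_mem [Fact (0 < ϱ)] (p : pseudosphere r s δ ϱ)
    (y : EuclideanSpace ℝ (Fin (r + s - 1)))
    (h : 0 < 1 - (form r s p p)⁻¹ *
      form r s ((perpEquiv p).symm y : Ambient r s) ((perpEquiv p).symm y)) :
    lift p y ∈ pseudosphere r s δ ϱ := by
  have hp := form_self_ne_zero p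
  have h1 := form_perp p ((perpEquiv p).symm y)
  have h2 := h1
  rw [form_symm] at h2
  have hs := Real.sq_sqrt h.le
  change form r s (lift p y) (lift p y) = _
  rw [← show form r s p p = sgn δ * (ϱ ^ 2)⁻¹ from p.2]
  simp only [lift, height, map_add, map_smul, add_apply,
    smul_apply, h1, h2, smul_eq_mul]
  set a := √(1 - (form r s p p)⁻¹ *
      form r s ((perpEquiv p).symm y : Ambient r s) ((perpEquiv p).symm y)) with ha
  have : a * (a * form r s p p) = a ^ 2 * form r s p p := by ring
  simp only [mul_zero, add_zero, zero_add]
  rw [this, hs]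
  field_simp
  ring

open Classical in
/-- The chart around `p`: the orthogonal projection of `{v : (p,v)/(p,p) > 0}` to the orthogonal
complement of `p`, with inverse `w ↦ √(1 - (w,w)/(p,p)) p + w`. -/
def chart [Fact (0 < ϱ)] (p : pseudosphere r s δ ϱ) :
    OpenPartialHomeomorph (pseudosphere r s δ ϱ) (EuclideanSpace ℝ (Fin (r + s - 1))) where
  toFun v := perpEquiv p (perpProj p v)
  invFun y := if h : lift p y ∈ pseudosphere r s δ ϱ then ⟨lift p y, h⟩ else p
  source := {v | 0 < (form r s p p)⁻¹ * form r s p v}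
  target := {y | 0 < 1 - (form r s p p)⁻¹ *
    form r s ((perpEquiv p).symm y : Ambient r s) ((perpEquiv p).symm y)}
  map_source' := by
    intro v hv
    have hp := form_self_ne_zero p
    have hvv : form r s (v : Ambient r s) v = form r s p p := form_self_eq v p
    have hvp : form r s (v : Ambient r s) p = form r s p v := form_symm _ _ _ _
    simp only [Set.mem_ofPred_eq, ContinuousLinearEquiv.symm_apply_apply, perpProj_coe, map_sub,
      map_smul, sub_apply, smul_apply, smul_eq_mul, hvv,
      hvp] at hv ⊢
    have : 1 - (form r s p p)⁻¹ * (form r s p p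
        - (form r s p p)⁻¹ * form r s p v * form r s p v
        - (form r s p p)⁻¹ * form r s p v * (form r s p v
          - (form r s p p)⁻¹ * form r s p v * form r s p p))
        = ((form r s p p)⁻¹ * form r s p v) ^ 2 := by
      field_simp
      ring
    have h2 := pow_pos hv 2
    rw [← this] at h2
    convert h2 using 1
  map_target' := by
    intro y hy
    have hp := form_self_ne_zero p
    have h1 := form_perp p ((perpEquiv p).symm y)
    simp only [Set.mem_ofPred_eq, dif_pos (lift_mem p y hy)]
    simp only [lift, map_add, map_smul, h1, smul_eq_mul, add_zero]
    have : 0 < height p ((perpEquiv p).symm y : Ambient r s) := Real.sqrt_pos.2 hy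
    field_simp
    exact this
  left_inv' := by
    intro v hv
    have hp := form_self_ne_zero p
    have hvv : form r s (v : Ambient r s) v = form r s p p := form_self_eq v p
    have hvp : form r s (v : Ambient r s) p = form r s p v := form_symm _ _ _ _
    have key : lift p (perpEquiv p (perpProj p v)) = v := by
      have h2 : height p (perpProj p (v : Ambient r s) : Ambient r s)
          = (form r s p p)⁻¹ * form r s p v := by
        unfold height
        rw [← Real.sqrt_sq (le_of_lt hv)]
        congr 1
        simp only [perpProj_coe, map_sub, map_smul, sub_apply,
          smul_apply, smul_eq_mul, hvv, hvp]
        field_simp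
        ring
      simp only [lift, ContinuousLinearEquiv.symm_apply_apply, h2]
      simp [perpProj_coe]
    have hmem : lift p (perpEquiv p (perpProj p v)) ∈ pseudosphere r s δ ϱ := by
      rw [key]; exact v.2
    rw [dif_pos hmem]
    exact Subtype.ext key
  right_inv' := by
    intro y hy
    have hp := form_self_ne_zero p
    have h1 := form_perp p ((perpEquiv p).symm y)
    simp only [dif_pos (lift_mem p y hy)]
    rw [ContinuousLinearEquiv.eq_symm_apply (perpEquiv p) |>.symm]
    apply Subtype.ext
    rw [perpProj_coe]
    simp only [lift, map_add, map_smul, h1, smul_eq_mul, add_zero]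
    have : (form r s p p)⁻¹ * (height p ((perpEquiv p).symm y : Ambient r s) * form r s p p)
      = height p ((perpEquiv p).symm y : Ambient r s) := by field_simp
    rw [this]
    abel
  open_source := by
    apply isOpen_lt continuous_const
    fun_prop
  open_target := by
    apply isOpen_lt continuous_const
    fun_prop
  continuousOn_toFun := by
    apply Continuous.continuousOn
    fun_prop
  continuousOn_invFun := by
    rw [Topology.IsInducing.subtypeVal.continuousOn_iff]
    have hc : Continuous (lift p) := by
      unfold lift height
      fun_prop
    refine hc.continuousOn.congr ?_
    intro y hy
    simp only [Function.comp, dif_pos (lift_mem p y hy)]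

instance [Fact (0 < ϱ)] :
    ChartedSpace (EuclideanSpace ℝ (Fin (r + s - 1))) (pseudosphere r s δ ϱ) where
  atlas := {e | ∃ p, e = chart p}
  chartAt := chart
  mem_chart_source p := by
    have := form_self_ne_zero p
    simp [chart, this]
  chart_mem_atlas p := ⟨p, rfl⟩

instance [Fact (0 < ϱ)] :
    IsManifold 𝓘(ℝ, EuclideanSpace ℝ (Fin (r + s - 1))) ∞ (pseudosphere r s δ ϱ) := by
  apply isManifold_of_contDiffOn
  rintro _ _ ⟨p, rfl⟩ ⟨q, rfl⟩
  have hl : ContDiffOn ℝ ∞ (lift p) (chart p).target := by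
    have hw : ContDiff ℝ ∞ (fun y ↦ ((perpEquiv p).symm y : Ambient r s)) :=
      ((perp (p : Ambient r s)).subtypeL.comp
        (perpEquiv p).symm.toContinuousLinearMap).contDiff
    have hh : ContDiffOn ℝ ∞ (fun y ↦ height p ((perpEquiv p).symm y : Ambient r s))
        (chart p).target := by
      unfold height
      refine ContDiffOn.sqrt (by fun_prop) ?_
      intro y hy
      exact ne_of_gt (show 0 < 1 - (form r s p p)⁻¹ *
        form r s ((perpEquiv p).symm y : Ambient r s) ((perpEquiv p).symm y) from hy)
    exact (hh.smul contDiffOn_const).add hw.contDiffOn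
  have hq : ContDiff ℝ ∞ (fun v : Ambient r s ↦ perpEquiv q (perpProj q v)) := by fun_prop
  refine ((hq.comp_contDiffOn hl).mono ?_).congr ?_
  · intro y hy
    simpa using hy.1.1
  · intro y hy
    have hy' : y ∈ (chart p).target := by simpa using hy.1.1
    simp [chart, Function.comp, dif_pos (lift_mem p y hy')]

open PseudoRiemannian

/-- The metric induced on the pseudo-sphere by the ambient inner product. -/
def inducedMetric (r s : ℕ) (δ : ℤˣ) (ϱ : ℝ) [Fact (0 < ϱ)] :
    FormField 𝓘(ℝ, EuclideanSpace ℝ (Fin (r + s - 1))) (pseudosphere r s δ ϱ) := fun p ↦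
  pullback (form r s) (mvfderiv 𝓘(ℝ, EuclideanSpace ℝ (Fin (r + s - 1)))
    (fun v : pseudosphere r s δ ϱ ↦ (v : Ambient r s)) p)

end PseudoSphere

/-! ### The warped products -/

namespace WarpedProduct

open PseudoRiemannian PseudoSphere

/-- The model with corners of the product of an interval and a pseudo-sphere. -/
abbrev model (r s : ℕ) :
    ModelWithCorners ℝ (ℝ × EuclideanSpace ℝ (Fin (r + s - 1)))
      (ModelProd ℝ (EuclideanSpace ℝ (Fin (r + s - 1)))) :=
  𝓘(ℝ, ℝ).prod 𝓘(ℝ, EuclideanSpace ℝ (Fin (r + s - 1)))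

variable {r s : ℕ} {δ : ℤˣ} {ϱ : ℝ} [Fact (0 < ϱ)] {J : TopologicalSpace.Opens ℝ}

/-- The one-form `dt` on `J × S`. -/
def dt (x : J × pseudosphere r s δ ϱ) : TangentSpace (model r s) x →L[ℝ] ℝ :=
  mvfderiv (model r s) (fun y : J × pseudosphere r s δ ϱ ↦ (y.1 : ℝ)) x

/-- The projection of a tangent vector of `J × S` to the tangent space of `S`. -/
def toSphere (x : J × pseudosphere r s δ ϱ) : TangentSpace (model r s) x →L[ℝ]
    TangentSpace 𝓘(ℝ, EuclideanSpace ℝ (Fin (r + s - 1))) x.2 :=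
  mfderiv (model r s) 𝓘(ℝ, EuclideanSpace ℝ (Fin (r + s - 1)))
    (fun y : J × pseudosphere r s δ ϱ ↦ y.2) x

/-- The metric `ε dt² + f(t) ds²` on `J × S`, where `ds²` is the metric of the pseudo-sphere. -/
def metric (r s : ℕ) (δ : ℤˣ) (ϱ : ℝ) [Fact (0 < ϱ)] (J : TopologicalSpace.Opens ℝ) (ε : ℤˣ)
    (f : ℝ → ℝ) : FormField (model r s) (J × pseudosphere r s δ ϱ) := fun x ↦
  sgn ε • (dt x).smulRight (dt x)
    + f x.1 • pullback (inducedMetric r s δ ϱ x.2) (toSphere x)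

/-- The endomorphism `φ` of the tangent spaces of `J × S`, with `φ ∂_t = ∂_t` and `φ = -id` on
the tangent vectors of the pseudo-sphere: here `T_x (J × S) = T J × T S`. -/
def phi (x : J × pseudosphere r s δ ϱ) :
    TangentSpace (model r s) x →ₗ[ℝ] TangentSpace (model r s) x :=
  (LinearMap.id : ℝ →ₗ[ℝ] ℝ).prodMap
    (-LinearMap.id : EuclideanSpace ℝ (Fin (r + s - 1)) →ₗ[ℝ] EuclideanSpace ℝ (Fin (r + s - 1)))

end WarpedProduct

end

open scoped Manifold ContDiff Topology

noncomputable section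

set_option linter.unusedSectionVars false

/-! The inclusion `emb` of `J × S` in `ℝ × ℝ^{r+s}` turns a vector field into a vector-valued
function, which the flat derivative `D` can differentiate. The Levi-Civita connection has the form
`∇_X Y = D_X Y + Γ(X, Y)`. For `X = (a, x)` and `Y = (b, y)` at `(t, p)`, put `κ₀ = (p, p)⁻¹` and
`Γ(X, Y) = (-(ε f'/2) (x, y), κ₀ (x, y) p + (f'/(2f)) (a y + b x))`. The term along `p` cancels the
normal part of `D_X Y`, because differentiating `(p, Y) = 0` gives `-(x, y)`; the other terms are
the Christoffel terms of the warping. `Γ` is symmetric, so there is no torsion, and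
`isLeviCivita_connection` checks compatibility with the metric. By `IsLeviCivita.unique` the
curvature may be computed from this one connection.

Since `D` is flat, only the skew part of `DΓ` and the commutator of `Γ` survive in the curvature
(`mvfderiv_emb_curvatureField`). Substituting `f'' = 2εκ` yields `C R_φ` (`productChr_curvature`):
planes tangent to `S` have sectional curvature `C`, those containing `∂_t` have `-C`, and `φ`
accounts for the sign. The numbers `κ` and `κ₀` can differ only if `dim S ≤ 1`, and there `(y, z) x
- (x, z) y = 0`.

The Jordan IP property is then linear algebra. As `φ` is an injective isometry, `T = R(π)` maps into
`φ(π)`, and on `φ(π)` it satisfies `T² = -C² σ`, where `σ = ±1` is the sign of the Gram determinant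
of `π`. Moreover `C ≠ 0`, because `f κ - ε f'²/4 = -(ε/4)(A² - 4εκB)`. Hence the space is `φ(π) ⊕
ker T`, the rank is `2`, and the conjugacy class depends only on `C² σ`
(`isCyclicPair_smul_rTensor`, `IsCyclicPair.jordanEquivalent`). -/

namespace PseudoRiemannian

/-! ### Second derivatives of vector-valued functions along vector fields, and the Lie bracket. -/

section Calculus

variable {E : Type*} [NormedAddCommGroup E] [NormedSpace ℝ E] [CompleteSpace E]
  {H : Type*} [TopologicalSpace H] {I : ModelWithCorners ℝ E H} [I.Boundaryless]
  {M : Type*} [TopologicalSpace M] [ChartedSpace H M] [IsManifold I 2 M]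
  {F : Type*} [NormedAddCommGroup F] [NormedSpace ℝ F]

theorem contDiffAt_comp_extChartAt_symm {h : M → F} {x : M} {n : ℕ∞ω}
    (hh : ContMDiffAt I 𝓘(ℝ, F) n h x) :
    ContDiffAt ℝ n (h ∘ (extChartAt I x).symm) (extChartAt I x x) := by
  have := (contMDiffAt_iff.1 hh).2
  rwa [I.range_eq_univ, contDiffWithinAt_univ] at this

/-- The vector field `Y` read in the chart at `x`. -/
def chartField (Y : VectField I M) (x : M) : E → E :=
  VectorField.mpullbackWithin 𝓘(ℝ, E) I (extChartAt I x).symm Y (Set.range I)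

theorem differentiableAt_chartField {Y : VectField I M} {x : M}
    (hY : MDifferentiableAt I I.tangent (fun y ↦ (⟨y, Y y⟩ : TangentBundle I M)) x) :
    DifferentiableAt ℝ (chartField Y x) (extChartAt I x x) := by
  have := (mdifferentiableWithinAt_univ.2 hY).differentiableWithinAt_mpullbackWithin_vectorField
  rw [Set.preimage_univ, Set.univ_inter, I.range_eq_univ] at this
  refine differentiableWithinAt_univ.1 ?_
  unfold chartField
  rw [I.range_eq_univ]
  exact this

theorem chartField_self (Y : VectField I M) (x : M) :
    chartField Y x (extChartAt I x x) = Y x := by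
  have h : (extChartAt I x).symm (extChartAt I x x) = x := extChartAt_to_inv x
  have := mfderivWithin_extChartAt_symm_inverse_apply (I := I) (x := x) (Y x)
  unfold chartField VectorField.mpullbackWithin
  refine Eq.trans ?_ this
  exact congrArg (fun v : E ↦ (mfderivWithin 𝓘(ℝ, E) I (extChartAt I x).symm (Set.range I)
    (extChartAt I x x)).inverse v) (congrArg (fun z ↦ (Y z : E)) h)

/-- The derivative of the inverse chart cancels against its inverse in the pullback of `Y`. The
identity is needed on a neighbourhood, since both sides get differentiated again. -/
theorem eventually_mvfderiv_comp_symm {h : M → F} {x : M} (Y : VectField I M)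
    (hh : ContMDiffAt I 𝓘(ℝ, F) 2 h x) :
    ∀ᶠ e in 𝓝 (extChartAt I x x),
      mvfderiv I h ((extChartAt I x).symm e) (Y ((extChartAt I x).symm e)) =
        fderiv ℝ (h ∘ (extChartAt I x).symm) e (chartField Y x e) := by
  have h1 : ∀ᶠ y in 𝓝 x, MDifferentiableAt I 𝓘(ℝ, F) h y :=
    ((contMDiffAt_iff_contMDiffAt_nhds (by simp)).1 hh).mono fun y hy ↦
      hy.mdifferentiableAt (by simp)
  have hc : Filter.Tendsto (extChartAt I x).symm (𝓝 (extChartAt I x x)) (𝓝 x) := by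
    have := continuousAt_extChartAt_symm (I := I) x
    rwa [ContinuousAt, extChartAt_to_inv x] at this
  filter_upwards [hc.eventually h1, extChartAt_target_mem_nhds (I := I) x] with e he het
  have hs : MDifferentiableAt 𝓘(ℝ, E) I (extChartAt I x).symm e := by
    have := mdifferentiableWithinAt_extChartAt_symm (I := I) het
    rwa [I.range_eq_univ, mdifferentiableWithinAt_univ] at this
  have hinv := isInvertible_mfderivWithin_extChartAt_symm (I := I) het
  have hcomp := mfderiv_comp e he hs
  rw [mfderiv_eq_fderiv] at hcomp
  rw [hcomp]
  unfold chartField VectorField.mpullbackWithin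
  rw [I.range_eq_univ, mfderivWithin_univ] at *
  change _ = mfderiv I 𝓘(ℝ, F) h _ (mfderiv 𝓘(ℝ, E) I (extChartAt I x).symm e _)
  obtain ⟨A, hA⟩ := hinv
  rw [← hA, ContinuousLinearMap.inverse_equiv]
  erw [A.apply_symm_apply]
  rfl

theorem hasFDerivAt_fderiv_chartField {h : M → F} {x : M} {Y : VectField I M}
    (hh : ContMDiffAt I 𝓘(ℝ, F) 2 h x)
    (hY : MDifferentiableAt I I.tangent (fun y ↦ (⟨y, Y y⟩ : TangentBundle I M)) x) :
    HasFDerivAt (fun e ↦ fderiv ℝ (h ∘ (extChartAt I x).symm) e (chartField Y x e))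
      (((fderiv ℝ (h ∘ (extChartAt I x).symm) (extChartAt I x x)).comp
        (fderiv ℝ (chartField Y x) (extChartAt I x x))) +
        (fderiv ℝ (fderiv ℝ (h ∘ (extChartAt I x).symm)) (extChartAt I x x)).flip
          (chartField Y x (extChartAt I x x)))
      (extChartAt I x x) := by
  have h1 : DifferentiableAt ℝ (fderiv ℝ (h ∘ (extChartAt I x).symm)) (extChartAt I x x) :=
    ((contDiffAt_comp_extChartAt_symm hh).fderiv_right (m := 1) le_rfl).differentiableAt (by simp)
  exact h1.hasFDerivAt.clm_apply (differentiableAt_chartField hY).hasFDerivAt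

theorem mdifferentiableAt_mvfderiv_apply {h : M → F} {x : M} {Y : VectField I M}
    (hh : ContMDiffAt I 𝓘(ℝ, F) 2 h x)
    (hY : MDifferentiableAt I I.tangent (fun y ↦ (⟨y, Y y⟩ : TangentBundle I M)) x) :
    MDifferentiableAt I 𝓘(ℝ, F) (fun y ↦ mvfderiv I h y (Y y)) x := by
  have h1 := (hasFDerivAt_fderiv_chartField hh hY).differentiableAt
  have h2 := h1.comp_mdifferentiableAt
    (mdifferentiableAt_extChartAt (I := I) (mem_chart_source H x))
  refine h2.congr_of_eventuallyEq ?_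
  have h3 := (continuousAt_extChartAt (I := I) x).eventually (eventually_mvfderiv_comp_symm Y hh)
  filter_upwards [h3, extChartAt_source_mem_nhds (I := I) x] with y hy hys
  rw [(extChartAt I x).left_inv hys] at hy
  exact hy

/-- The product rule in the chart. The Hessian term is isolated because it is symmetric in `u` and
`Y x`, and so drops out of commutators. -/
theorem mvfderiv_mvfderiv_apply {h : M → F} {x : M} {Y : VectField I M}
    (hh : ContMDiffAt I 𝓘(ℝ, F) 2 h x)
    (hY : MDifferentiableAt I I.tangent (fun y ↦ (⟨y, Y y⟩ : TangentBundle I M)) x)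
    (u : TangentSpace I x) :
    mvfderiv I (fun y ↦ mvfderiv I h y (Y y)) x u =
      fderiv ℝ (h ∘ (extChartAt I x).symm) (extChartAt I x x)
        (fderiv ℝ (chartField Y x) (extChartAt I x x) u) +
      fderiv ℝ (fderiv ℝ (h ∘ (extChartAt I x).symm)) (extChartAt I x x) u (Y x) := by
  rw [(mdifferentiableAt_mvfderiv_apply hh hY).mvfderiv, I.range_eq_univ, fderivWithin_univ]
  have h1 := hasFDerivAt_fderiv_chartField hh hY
  have h2 : writtenInExtChartAt I 𝓘(ℝ, F) x (fun y ↦ mvfderiv I h y (Y y)) =ᶠ[𝓝 (extChartAt I x x)]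
      (fun e ↦ fderiv ℝ (h ∘ (extChartAt I x).symm) e (chartField Y x e)) :=
    eventually_mvfderiv_comp_symm Y hh
  rw [(h1.congr_of_eventuallyEq h2).fderiv, chartField_self]
  rfl

/-- Applied to an immersion `h`, this determines the bracket from derivatives of vector-valued
functions; applied to the image of a field, it says that the flat derivative has no curvature. -/
theorem mvfderiv_mlieBracket {h : M → F} {x : M} {X Y : VectField I M}
    (hh : ContMDiffAt I 𝓘(ℝ, F) 2 h x)
    (hX : MDifferentiableAt I I.tangent (fun y ↦ (⟨y, X y⟩ : TangentBundle I M)) x)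
    (hY : MDifferentiableAt I I.tangent (fun y ↦ (⟨y, Y y⟩ : TangentBundle I M)) x) :
    mvfderiv I h x (VectorField.mlieBracket I X Y x) =
      mvfderiv I (fun y ↦ mvfderiv I h y (Y y)) x (X x) -
        mvfderiv I (fun y ↦ mvfderiv I h y (X y)) x (Y x) := by
  rw [mvfderiv_mvfderiv_apply hh hX, mvfderiv_mvfderiv_apply hh hY,
    (hh.mdifferentiableAt (by simp)).mvfderiv, I.range_eq_univ, fderivWithin_univ]
  have hsymm := ((contDiffAt_comp_extChartAt_symm hh).isSymmSndFDerivAt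
    (by simp)).eq (X x) (Y x)
  -- At its own base point the chart has the identity as derivative, so the bracket is the
  -- coordinate bracket.
  have hb : VectorField.mlieBracket I X Y x =
      fderiv ℝ (chartField Y x) (extChartAt I x x) (X x) -
        fderiv ℝ (chartField X x) (extChartAt I x x) (Y x) := by
    rw [← VectorField.mlieBracketWithin_univ, VectorField.mlieBracketWithin_apply]
    rw [mfderiv_extChartAt_self]
    change (ContinuousLinearMap.id ℝ E).inverse
      (VectorField.lieBracketWithin ℝ (chartField X x) (chartField Y x)
        (Set.univ ∩ Set.range I) (extChartAt I x x)) = _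
    rw [ContinuousLinearMap.inverse_id, Set.univ_inter, I.range_eq_univ,
      VectorField.lieBracketWithin_univ, VectorField.lieBracket, chartField_self, chartField_self]
    rfl
  rw [hb, hsymm]
  erw [map_sub]
  change _ - _ = _ + _ - (_ + _)
  exact (add_sub_add_right_eq_sub _ _ _).symm

end Calculus

/-! ### Regularity of fields and forms, tested through a map to a vector space. -/

section Coordinates

variable {E : Type*} [NormedAddCommGroup E] [NormedSpace ℝ E]
  {H : Type*} [TopologicalSpace H] {I : ModelWithCorners ℝ E H}
  {M : Type*} [TopologicalSpace M] [ChartedSpace H M] [IsManifold I 1 M]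
  {F : Type*} [NormedAddCommGroup F] [NormedSpace ℝ F]

/-- The derivative of `h` at `y`, read in the trivialization of the tangent bundle at `x`. -/
def coordDeriv (I : ModelWithCorners ℝ E H) [IsManifold I 1 M] (h : M → F) (x y : M) : E →L[ℝ] F :=
  (mvfderiv I h y).comp ((trivializationAt E (TangentSpace I : M → Type _) x).symmL ℝ y)

theorem coordDeriv_apply (h : M → F) {x y : M}
    (hy : y ∈ (trivializationAt E (TangentSpace I : M → Type _) x).baseSet)
    (v : TangentSpace I y) :
    coordDeriv I h x y (trivializationAt E (TangentSpace I : M → Type _) x ⟨y, v⟩).2 =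
      mvfderiv I h y v := by
  simp only [coordDeriv, ContinuousLinearMap.comp_apply]
  congr 1
  have := (trivializationAt E (TangentSpace I : M → Type _) x).symmL_continuousLinearMapAt
    (R := ℝ) hy v
  rw [Bundle.Trivialization.continuousLinearMapAt_apply,
    Bundle.Trivialization.coe_linearMapAt_of_mem _ hy] at this
  exact this

theorem contMDiffAt_coordDeriv {h : M → F} {x : M} {m n : ℕ∞ω} 
    [IsManifold I n M] (hh : ContMDiffAt I 𝓘(ℝ, F) n h x)
    (hmn : m + 1 ≤ n) :
    ContMDiffAt I 𝓘(ℝ, E →L[ℝ] F) m (coordDeriv I h x) x := by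
  have := hh.mfderiv_const hmn
  refine this.congr_of_eventuallyEq (Filter.Eventually.of_forall fun y ↦ ?_)
  unfold inTangentCoordinates ContinuousLinearMap.inCoordinates
  ext v
  erw [TangentBundle.continuousLinearMapAt_model_space]
  rfl

/-- In the trivialization at `x`, the field `W` is `B⁻¹` applied to a fixed linear image of `dh(W)`.
Here `B` is the derivative of `h` followed by the left inverse `ρ` frozen at `x`; it is the identity
at `x`, hence invertible nearby, and inversion is differentiable. -/
theorem mdifferentiableAt_of_mvfderiv_apply [CompleteSpace E] [IsManifold I 2 M]
    {h : M → F} {x : M} {W : VectField I M}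
    (hh : ContMDiffAt I 𝓘(ℝ, F) 2 h x) (ρ : F →L[ℝ] TangentSpace I x)
    (hρ : ∀ v, ρ (mvfderiv I h x v) = v)
    (hW : MDifferentiableAt I 𝓘(ℝ, F) (fun y ↦ mvfderiv I h y (W y)) x) :
    MDifferentiableAt I I.tangent (fun y ↦ (⟨y, W y⟩ : TangentBundle I M)) x := by
  set e := trivializationAt E (TangentSpace I : M → Type _) x with he
  have hx : x ∈ e.baseSet := FiberBundle.mem_baseSet_trivializationAt' x
  rw [mdifferentiableAt_section]
  let ρ' : F →L[ℝ] E := (e.continuousLinearMapAt ℝ x).comp ρ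
  let B : M → E →L[ℝ] E := fun y ↦ ρ'.comp (coordDeriv I h x y)
  have hB : MDifferentiableAt I 𝓘(ℝ, E →L[ℝ] E) B x := by
    have h1 := (contMDiffAt_coordDeriv hh (m := 1) le_rfl).mdifferentiableAt (by simp)
    exact (mdifferentiableAt_const (c := ρ')).clm_comp h1
  have hBx : B x = 1 := by
    ext v
    obtain ⟨w, rfl⟩ : ∃ w : TangentSpace I x, (e ⟨x, w⟩).2 = v :=
      ⟨e.symmL ℝ x v, by
        have := e.continuousLinearMapAt_symmL (R := ℝ) hx v
        rw [Bundle.Trivialization.continuousLinearMapAt_apply,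
          Bundle.Trivialization.coe_linearMapAt_of_mem _ hx] at this
        exact this⟩
    simp only [B, ρ', ContinuousLinearMap.comp_apply]
    rw [coordDeriv_apply h hx, hρ, Bundle.Trivialization.continuousLinearMapAt_apply,
      Bundle.Trivialization.coe_linearMapAt_of_mem _ hx]
    rfl
  have hinv : MDifferentiableAt I 𝓘(ℝ, E →L[ℝ] E) (fun y ↦ Ring.inverse (B y)) x := by
    have h1 : DifferentiableAt ℝ (Ring.inverse : (E →L[ℝ] E) → _) (B x) := by
      rw [hBx]
      exact (contDiffAt_ringInverse ℝ (1 : (E →L[ℝ] E)ˣ) (n := 1)).differentiableAt (by simp)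
    exact h1.comp_mdifferentiableAt hB
  have hu : ∀ᶠ y in 𝓝 x, IsUnit (B y) := by
    refine hB.continuousAt.eventually ?_
    rw [hBx]
    exact Units.nhds 1
  have hρW : MDifferentiableAt I 𝓘(ℝ, E) (fun y ↦ ρ' (mvfderiv I h y (W y))) x :=
    ρ'.differentiableAt.comp_mdifferentiableAt hW
  refine (hinv.clm_apply hρW).congr_of_eventuallyEq ?_
  filter_upwards [hu, e.open_baseSet.mem_nhds hx] with y hy hye
  rw [← coordDeriv_apply h hye]
  change _ = Ring.inverse (B y) (B y _)
  exact (congrArg (fun T : E →L[ℝ] E ↦ T (e ⟨y, W y⟩).2) (Ring.inverse_mul_cancel _ hy)).symm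

/-- In a trivialization `g` is the smooth family `G` composed in both slots with the smooth
coordinate derivative of `h`. -/
theorem contMDiff_formField {h : M → F} {G : M → F →L[ℝ] F →L[ℝ] ℝ} {g : FormField I M}
    [IsManifold I ∞ M] (hh : ContMDiff I 𝓘(ℝ, F) ∞ h)
    (hG : ContMDiff I 𝓘(ℝ, F →L[ℝ] F →L[ℝ] ℝ) ∞ G)
    (hg : ∀ x u v, g x u v = G x (mvfderiv I h x u) (mvfderiv I h x v)) :
    ContMDiff I (I.prod 𝓘(ℝ, E →L[ℝ] E →L[ℝ] ℝ)) ∞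
    (fun x ↦ Bundle.TotalSpace.mk' (E →L[ℝ] E →L[ℝ] ℝ)
      (E := fun x : M ↦ TangentSpace I x →L[ℝ] TangentSpace I x →L[ℝ] ℝ) x (g x)) := by
  intro x
  rw [contMDiffAt_hom_bundle]
  refine ⟨contMDiffAt_id, ?_⟩
  have hA := contMDiffAt_coordDeriv (m := ∞) (hh x) (by simp)
  have h1 : ContMDiffAt I 𝓘(ℝ, E →L[ℝ] E →L[ℝ] ℝ) ∞
      (fun y ↦ (ContinuousLinearMap.precomp ℝ (coordDeriv I h x y)).comp
        ((G y).comp (coordDeriv I h x y))) x := by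
    have h2 : ContMDiffAt I 𝓘(ℝ, (F →L[ℝ] ℝ) →L[ℝ] (E →L[ℝ] ℝ)) ∞
        (fun y ↦ ContinuousLinearMap.precomp ℝ (coordDeriv I h x y)) x :=
      hA.clm_precomp
    exact h2.clm_comp ((hG x).clm_comp hA)
  refine h1.congr_of_eventuallyEq ?_
  have hb := (trivializationAt E (TangentSpace I : M → Type _) x).open_baseSet.mem_nhds
    (FiberBundle.mem_baseSet_trivializationAt' x)
  filter_upwards [hb] with y hy
  ext u v
  rw [inCoordinates_apply_eq₂ hy hy (by simp)]
  simp [coordDeriv, hg, Bundle.Trivialization.symmL_apply _ hy]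

end Coordinates

/-! ### Uniqueness of the Levi-Civita connection. -/

section Uniqueness

variable {E : Type*} [NormedAddCommGroup E] [NormedSpace ℝ E]
  {H : Type*} [TopologicalSpace H] {I : ModelWithCorners ℝ E H}
  {M : Type*} [TopologicalSpace M] [ChartedSpace H M] [IsManifold I ∞ M] [FiniteDimensional ℝ E]
  {g : FormField I M} {cov cov' : CovariantDerivative I E (TangentSpace I : M → Type _)}

/-- The difference `A` of two such connections satisfies `A(X, Y) = A(Y, X)`, and `g(A(X, Y), W)` is
skew in `Y, W`. A trilinear expression symmetric in one pair of slots and skew in an overlapping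
pair vanishes. -/
theorem IsLeviCivita.unique (hs : ∀ (x : M) (u v : TangentSpace I x), g x u v = g x v u)
    (hn : ∀ (x : M) (u : TangentSpace I x), (∀ v, g x u v = 0) → u = 0)
    (h : IsLeviCivita I g cov) (h' : IsLeviCivita I g cov') {x : M} {Z : VectField I M}
    (hZ : MDifferentiableAt I I.tangent (fun y ↦ (⟨y, Z y⟩ : TangentBundle I M)) x) :
    cov Z x = cov' Z x := by
  have key : ∀ X Y W : VectField I M,
      MDifferentiableAt I I.tangent (fun y ↦ (⟨y, X y⟩ : TangentBundle I M)) x →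
      MDifferentiableAt I I.tangent (fun y ↦ (⟨y, Y y⟩ : TangentBundle I M)) x →
      MDifferentiableAt I I.tangent (fun y ↦ (⟨y, W y⟩ : TangentBundle I M)) x →
      g x (cov Y x (X x) - cov' Y x (X x)) (W x) = 0 := by
    intro X Y W hX hY hW
    have tor : ∀ X Y : VectField I M,
        MDifferentiableAt I I.tangent (fun y ↦ (⟨y, X y⟩ : TangentBundle I M)) x →
        MDifferentiableAt I I.tangent (fun y ↦ (⟨y, Y y⟩ : TangentBundle I M)) x →
        cov Y x (X x) - cov' Y x (X x) = cov X x (Y x) - cov' X x (Y x) := by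
      intro X Y hX hY
      rw [sub_eq_sub_iff_sub_eq_sub, h.1 x X Y hX hY, h'.1 x X Y hX hY]
    have met : ∀ X Y W : VectField I M,
        MDifferentiableAt I I.tangent (fun y ↦ (⟨y, Y y⟩ : TangentBundle I M)) x →
        MDifferentiableAt I I.tangent (fun y ↦ (⟨y, W y⟩ : TangentBundle I M)) x →
        g x (cov Y x (X x) - cov' Y x (X x)) (W x) =
          - g x (cov W x (X x) - cov' W x (X x)) (Y x) := by
      intro X Y W hY hW
      have e1 := h.2 x Y W hY hW (X x)
      have e2 := h'.2 x Y W hY hW (X x)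
      rw [e1, hs x (Y x), hs x (Y x)] at e2
      simp only [map_sub, sub_apply]
      linarith
    -- Three skew exchanges, interleaved with the symmetry `tor`, lead back to the initial value
    -- with the opposite sign.
    have e1 := met X Y W hY hW
    have e2 := met W X Y hX hY
    have e3 := met Y W X hW hX
    rw [tor X W hX hW] at e1
    rw [tor W Y hW hY] at e2
    rw [tor Y X hY hX] at e3
    linarith
  ext u
  rw [← sub_eq_zero]
  apply hn
  intro v
  have := key (FiberBundle.extend E u) Z (FiberBundle.extend E v)
    (FiberBundle.mdifferentiableAt_extend ..) hZ (FiberBundle.mdifferentiableAt_extend ..)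
  simpa using this

/-- Uniqueness holds only on differentiable fields. To use it on the outer derivative in `∇_X ∇_Y
Z`, the inner field `∇_Y Z` must be differentiable; this is what `hreg` supplies. -/
theorem isRiemannCurvature_of_isLeviCivita {R : CurvField I M}
    (hs : ∀ (x : M) (u v : TangentSpace I x), g x u v = g x v u)
    (hn : ∀ (x : M) (u : TangentSpace I x), (∀ v, g x u v = 0) → u = 0)
    (hcov : IsLeviCivita I g cov)
    (hreg : ∀ (x : M) (Y Z : VectField I M),
      ContMDiffAt I I.tangent ∞ (fun y ↦ (⟨y, Y y⟩ : TangentBundle I M)) x →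
      ContMDiffAt I I.tangent ∞ (fun y ↦ (⟨y, Z y⟩ : TangentBundle I M)) x →
      MDifferentiableAt I I.tangent (fun y ↦ (⟨y, cov Z y (Y y)⟩ : TangentBundle I M)) x)
    (hR : ∀ (x : M) (X Y Z : VectField I M),
      ContMDiffAt I I.tangent ∞ (fun y ↦ (⟨y, X y⟩ : TangentBundle I M)) x →
      ContMDiffAt I I.tangent ∞ (fun y ↦ (⟨y, Y y⟩ : TangentBundle I M)) x →
      ContMDiffAt I I.tangent ∞ (fun y ↦ (⟨y, Z y⟩ : TangentBundle I M)) x →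
      curvatureField I cov X Y Z x = R x (X x) (Y x) (Z x)) :
    IsRiemannCurvature I g R := by
  refine ⟨⟨cov, hcov⟩, fun cov' hcov' x X Y Z hX hY hZ ↦ ?_⟩
  rw [← hR x X Y Z hX hY hZ]
  have hZe : ∀ᶠ y in 𝓝 x, cov' Z y = cov Z y := by
    have h1 : ContMDiffAt I I.tangent 1 (fun y ↦ (⟨y, Z y⟩ : TangentBundle I M)) x :=
      hZ.of_le (by simp)
    filter_upwards [(contMDiffAt_iff_contMDiffAt_nhds (by simp)).1 h1] with y hy
    exact hcov'.unique hs hn hcov (hy.mdifferentiableAt (by simp))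
  have step : ∀ Y : VectField I M,
      ContMDiffAt I I.tangent ∞ (fun y ↦ (⟨y, Y y⟩ : TangentBundle I M)) x →
      cov' (fun y ↦ cov' Z y (Y y)) x = cov (fun y ↦ cov Z y (Y y)) x := by
    intro Y hY
    have hev : ∀ᶠ y in 𝓝 x, cov' Z y (Y y) = cov Z y (Y y) := by
      filter_upwards [hZe] with y hy
      rw [hy]
    have hd := hreg x Y Z hY hZ
    have hd' : MDifferentiableAt I I.tangent
        (fun y ↦ (⟨y, cov' Z y (Y y)⟩ : TangentBundle I M)) x := by
      refine hd.congr_of_eventuallyEq ?_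
      filter_upwards [hev] with y hy
      rw [hy]
    rw [← hcov'.unique hs hn hcov hd]
    exact cov'.isCovariantDerivativeOnUniv.congr_of_eventuallyEq hd' hd Filter.univ_mem hev
  unfold curvatureField
  rw [step Y hY, step X hX, hZe.self_of_nhds]

end Uniqueness

/-! ### Connections of the form `D + Γ` on an immersed manifold. -/

section Embedded

variable {E : Type*} [NormedAddCommGroup E] [NormedSpace ℝ E]
  {H : Type*} [TopologicalSpace H] {I : ModelWithCorners ℝ E H}
  {M : Type*} [TopologicalSpace M] [ChartedSpace H M] [IsManifold I ∞ M]
  {F : Type*} [NormedAddCommGroup F] [NormedSpace ℝ F]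

theorem contMDiffAt_mvfderiv_apply {h : M → F} {x : M} {Z : VectField I M}
    (hh : ContMDiffAt I 𝓘(ℝ, F) ∞ h x)
    (hZ : ContMDiffAt I I.tangent ∞ (fun y ↦ (⟨y, Z y⟩ : TangentBundle I M)) x) :
    ContMDiffAt I 𝓘(ℝ, F) ∞ (fun y ↦ mvfderiv I h y (Z y)) x := by
  have hA := contMDiffAt_coordDeriv (m := ∞) hh (by simp)
  rw [Bundle.contMDiffAt_section] at hZ
  refine (hA.clm_apply hZ).congr_of_eventuallyEq ?_
  have hb := (trivializationAt E (TangentSpace I : M → Type _) x).open_baseSet.mem_nhds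
    (FiberBundle.mem_baseSet_trivializationAt' x)
  filter_upwards [hb] with y hy
  rw [coordDeriv_apply h hy]

theorem mvfderiv_clm_apply {F' : Type*} [NormedAddCommGroup F'] [NormedSpace ℝ F']
    {A : M → F →L[ℝ] F'} {v : M → F} {x : M} (hA : MDifferentiableAt I 𝓘(ℝ, F →L[ℝ] F') A x)
    (hv : MDifferentiableAt I 𝓘(ℝ, F) v x) (u : TangentSpace I x) :
    mvfderiv I (fun y ↦ A y (v y)) x u = mvfderiv I A x u (v x) + A x (mvfderiv I v x u) := by
  have h1 := hA.hasMFDerivAt.2.clm_apply hv.hasMFDerivAt.2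
  have h2 := h1.fderivWithin (I.uniqueDiffOn _ (Set.mem_range_self _))
  rw [(hA.clm_apply hv).mvfderiv]
  refine (congrArg (fun T : E →L[ℝ] F' ↦ T u) h2).trans ?_
  have hx : (extChartAt I x).symm (extChartAt I x x) = x := extChartAt_to_inv x
  change A ((extChartAt I x).symm (extChartAt I x x)) (mvfderiv I v x u) +
    mvfderiv I A x u (v ((extChartAt I x).symm (extChartAt I x x))) = _
  rw [hx, add_comm]

variable (I M F) in
/-- A smooth immersion `emb` of `M` into a vector space, with a bilinear map `chr` such that
`D_X Y + chr(X, Y)` is tangent to `M` for all tangent vector fields `X` and `Y`. -/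
structure ImmersedConnection where
  /-- The immersion. -/
  emb : M → F
  /-- A left inverse of the derivative of the immersion. -/
  retr : ∀ x : M, F →L[ℝ] TangentSpace I x
  /-- The Christoffel tensor. -/
  chr : M → F →L[ℝ] F →L[ℝ] F
  contMDiff_emb : ContMDiff I 𝓘(ℝ, F) ∞ emb
  contMDiff_chr : ContMDiff I 𝓘(ℝ, F →L[ℝ] F →L[ℝ] F) ∞ chr
  retr_mvfderiv : ∀ (x : M) (v : TangentSpace I x), retr x (mvfderiv I emb x v) = v
  tangent : ∀ (x : M) (Z : VectField I M),
    MDifferentiableAt I I.tangent (fun y ↦ (⟨y, Z y⟩ : TangentBundle I M)) x →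
    ∀ u : TangentSpace I x,
      mvfderiv I emb x (retr x (mvfderiv I (fun y ↦ mvfderiv I emb y (Z y)) x u +
        chr x (mvfderiv I emb x u) (mvfderiv I emb x (Z x)))) =
      mvfderiv I (fun y ↦ mvfderiv I emb y (Z y)) x u +
        chr x (mvfderiv I emb x u) (mvfderiv I emb x (Z x))

namespace ImmersedConnection

variable (D : ImmersedConnection I M F)

theorem mvfderiv_emb_injective (x : M) : Function.Injective (mvfderiv I D.emb x) :=
  Function.LeftInverse.injective (D.retr_mvfderiv x)

variable [FiniteDimensional ℝ E] [I.Boundaryless]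

theorem mdifferentiableAt_image {x : M} {Z : VectField I M}
    (hZ : MDifferentiableAt I I.tangent (fun y ↦ (⟨y, Z y⟩ : TangentBundle I M)) x) :
    MDifferentiableAt I 𝓘(ℝ, F) (fun y ↦ mvfderiv I D.emb y (Z y)) x :=
  have := FiniteDimensional.complete ℝ E
  mdifferentiableAt_mvfderiv_apply ((D.contMDiff_emb x).of_le (by norm_cast)) hZ

/-- The covariant derivative `∇_X Y = D_X Y + chr(X, Y)`. -/
def cov : CovariantDerivative I E (TangentSpace I : M → Type _) where
  toFun Z x := (D.retr x).comp (mvfderiv I (fun y ↦ mvfderiv I D.emb y (Z y)) x +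
    ((D.chr x).flip (mvfderiv I D.emb x (Z x))).comp (mvfderiv I D.emb x))
  isCovariantDerivativeOnUniv :=
    { add := by
        intro Y Z x hY hZ _
        ext u
        have h : (fun y ↦ mvfderiv I D.emb y ((Y + Z) y)) =
            (fun y ↦ mvfderiv I D.emb y (Y y)) + fun y ↦ mvfderiv I D.emb y (Z y) := by
          ext1 y
          exact map_add _ _ _
        have h' := mvfderiv_add (D.mdifferentiableAt_image hY) (D.mdifferentiableAt_image hZ)
        rw [← h] at h'
        change D.retr x (mvfderiv I (fun y ↦ mvfderiv I D.emb y ((Y + Z) y)) x u +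
            D.chr x (mvfderiv I D.emb x u) (mvfderiv I D.emb x (Y x + Z x))) =
          D.retr x (mvfderiv I (fun y ↦ mvfderiv I D.emb y (Y y)) x u +
            D.chr x (mvfderiv I D.emb x u) (mvfderiv I D.emb x (Y x))) +
          D.retr x (mvfderiv I (fun y ↦ mvfderiv I D.emb y (Z y)) x u +
            D.chr x (mvfderiv I D.emb x u) (mvfderiv I D.emb x (Z x)))
        rw [h', ← map_add]
        simp only [add_apply, map_add]
        abel
      leibniz := by
        intro Z f x hZ hf _
        ext u
        have h : (fun y ↦ mvfderiv I D.emb y ((f • Z) y)) =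
            f • (fun y ↦ mvfderiv I D.emb y (Z y)) := by
          ext1 y
          exact map_smul _ _ _
        have h' := mvfderiv_smul hf (D.mdifferentiableAt_image hZ)
        rw [← h] at h'
        change D.retr x (mvfderiv I (fun y ↦ mvfderiv I D.emb y ((f • Z) y)) x u +
            D.chr x (mvfderiv I D.emb x u) (mvfderiv I D.emb x (f x • Z x))) =
          f x • D.retr x (mvfderiv I (fun y ↦ mvfderiv I D.emb y (Z y)) x u +
            D.chr x (mvfderiv I D.emb x u) (mvfderiv I D.emb x (Z x))) + mvfderiv I f x u • Z x
        rw [h']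
        simp only [add_apply, map_add, map_smul, smul_apply,
          ContinuousLinearMap.smulRight_apply, D.retr_mvfderiv]
        module }

theorem mvfderiv_emb_cov {x : M} {Z : VectField I M}
    (hZ : MDifferentiableAt I I.tangent (fun y ↦ (⟨y, Z y⟩ : TangentBundle I M)) x)
    (u : TangentSpace I x) :
    mvfderiv I D.emb x (D.cov Z x u) = mvfderiv I (fun y ↦ mvfderiv I D.emb y (Z y)) x u +
        D.chr x (mvfderiv I D.emb x u) (mvfderiv I D.emb x (Z x)) :=
  D.tangent x Z hZ u

/-- The symmetric Christoffel terms cancel, and what remains is the commutator of derivatives of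
`emb`, that is, the image of the bracket. -/
theorem cov_sub_cov (hsymm : ∀ x u v, D.chr x (mvfderiv I D.emb x u) (mvfderiv I D.emb x v) =
      D.chr x (mvfderiv I D.emb x v) (mvfderiv I D.emb x u)) {x : M} {X Y : VectField I M}
    (hX : MDifferentiableAt I I.tangent (fun y ↦ (⟨y, X y⟩ : TangentBundle I M)) x)
    (hY : MDifferentiableAt I I.tangent (fun y ↦ (⟨y, Y y⟩ : TangentBundle I M)) x) :
    D.cov Y x (X x) - D.cov X x (Y x) = VectorField.mlieBracket I X Y x := by
  have := FiniteDimensional.complete ℝ E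
  apply D.mvfderiv_emb_injective x
  rw [map_sub, D.mvfderiv_emb_cov hX, D.mvfderiv_emb_cov hY, hsymm x (X x) (Y x),
    mvfderiv_mlieBracket ((D.contMDiff_emb x).of_le (by norm_cast)) hX hY]
  abel

/-- By the product rule for `G(Y, Z)`, the derivatives of `Y` and `Z` match automatically, so
compatibility reduces to the pointwise identity `hcompat` between `DG` and the Christoffel tensor.
-/
theorem isLeviCivita {g : FormField I M} {G : M → F →L[ℝ] F →L[ℝ] ℝ}
    (hsymm : ∀ x u v, D.chr x (mvfderiv I D.emb x u) (mvfderiv I D.emb x v) =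
      D.chr x (mvfderiv I D.emb x v) (mvfderiv I D.emb x u))
    (hG : ContMDiff I 𝓘(ℝ, F →L[ℝ] F →L[ℝ] ℝ) ∞ G)
    (hg : ∀ x u v, g x u v = G x (mvfderiv I D.emb x u) (mvfderiv I D.emb x v))
    (hcompat : ∀ x u v w, mvfderiv I G x u (mvfderiv I D.emb x v) (mvfderiv I D.emb x w) =
      G x (D.chr x (mvfderiv I D.emb x u) (mvfderiv I D.emb x v)) (mvfderiv I D.emb x w) +
      G x (mvfderiv I D.emb x v) (D.chr x (mvfderiv I D.emb x u) (mvfderiv I D.emb x w))) :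
    IsLeviCivita I g D.cov := by
  refine ⟨fun x X Y hX hY ↦ D.cov_sub_cov hsymm hX hY, fun x Y Z hY hZ u ↦ ?_⟩
  have hG1 : MDifferentiableAt I 𝓘(ℝ, F →L[ℝ] F →L[ℝ] ℝ) G x :=
    (hG x).mdifferentiableAt (by simp)
  have hY1 := D.mdifferentiableAt_image hY
  have hZ1 := D.mdifferentiableAt_image hZ
  simp only [hg]
  rw [mvfderiv_clm_apply (hG1.clm_apply hY1) hZ1, mvfderiv_clm_apply hG1 hY1,
    D.mvfderiv_emb_cov hY, D.mvfderiv_emb_cov hZ]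
  simp only [map_add, add_apply, hcompat]
  ring

theorem mdifferentiableAt_cov {x : M} {Y Z : VectField I M}
    (hY : ContMDiffAt I I.tangent ∞ (fun y ↦ (⟨y, Y y⟩ : TangentBundle I M)) x)
    (hZ : ContMDiffAt I I.tangent ∞ (fun y ↦ (⟨y, Z y⟩ : TangentBundle I M)) x) :
    MDifferentiableAt I 𝓘(ℝ, F) (fun y ↦ mvfderiv I (fun z ↦ mvfderiv I D.emb z (Z z)) y (Y y)) x ∧
    (∀ᶠ y in 𝓝 x, mvfderiv I D.emb y (D.cov Z y (Y y)) =
      mvfderiv I (fun z ↦ mvfderiv I D.emb z (Z z)) y (Y y) +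
        D.chr y (mvfderiv I D.emb y (Y y)) (mvfderiv I D.emb y (Z y))) ∧
    MDifferentiableAt I I.tangent (fun y ↦ (⟨y, D.cov Z y (Y y)⟩ : TangentBundle I M)) x := by
  have := FiniteDimensional.complete ℝ E
  have hY1 := hY.mdifferentiableAt (by simp)
  have hZ1 := hZ.mdifferentiableAt (by simp)
  have hz := contMDiffAt_mvfderiv_apply (D.contMDiff_emb x) hZ
  have h1 := mdifferentiableAt_mvfderiv_apply (hz.of_le (by norm_cast)) hY1
  have h2 : ∀ᶠ y in 𝓝 x, mvfderiv I D.emb y (D.cov Z y (Y y)) =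
      mvfderiv I (fun z ↦ mvfderiv I D.emb z (Z z)) y (Y y) +
        D.chr y (mvfderiv I D.emb y (Y y)) (mvfderiv I D.emb y (Z y)) := by
    have h1 : ContMDiffAt I I.tangent 1 (fun y ↦ (⟨y, Z y⟩ : TangentBundle I M)) x :=
      hZ.of_le (by simp)
    filter_upwards [(contMDiffAt_iff_contMDiffAt_nhds (by simp)).1 h1] with y hy
    exact D.mvfderiv_emb_cov (hy.mdifferentiableAt (by simp)) _
  refine ⟨h1, h2, ?_⟩
  refine mdifferentiableAt_of_mvfderiv_apply ((D.contMDiff_emb x).of_le (by norm_cast))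
    (D.retr x) (D.retr_mvfderiv x) ?_
  have hc : MDifferentiableAt I 𝓘(ℝ, F →L[ℝ] F →L[ℝ] F) D.chr x :=
    (D.contMDiff_chr x).mdifferentiableAt (by simp)
  refine (h1.add ((hc.clm_apply (D.mdifferentiableAt_image hY1)).clm_apply
    (D.mdifferentiableAt_image hZ1))).congr_of_eventuallyEq ?_
  exact h2

/-- The second derivatives of `Z` cancel against `D_{[X,Y]} Z`, the first derivatives of `X` and `Y`
against the Christoffel term of `[X, Y]`, and those of `Z` between the two orders of
differentiation. -/
theorem mvfderiv_emb_curvatureField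
    {x : M} {X Y Z : VectField I M}
    (hX : ContMDiffAt I I.tangent ∞ (fun y ↦ (⟨y, X y⟩ : TangentBundle I M)) x)
    (hY : ContMDiffAt I I.tangent ∞ (fun y ↦ (⟨y, Y y⟩ : TangentBundle I M)) x)
    (hZ : ContMDiffAt I I.tangent ∞ (fun y ↦ (⟨y, Z y⟩ : TangentBundle I M)) x) :
    mvfderiv I D.emb x (curvatureField I D.cov X Y Z x) =
      mvfderiv I D.chr x (X x) (mvfderiv I D.emb x (Y x)) (mvfderiv I D.emb x (Z x)) -
      mvfderiv I D.chr x (Y x) (mvfderiv I D.emb x (X x)) (mvfderiv I D.emb x (Z x)) +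
      D.chr x (mvfderiv I D.emb x (X x))
        (D.chr x (mvfderiv I D.emb x (Y x)) (mvfderiv I D.emb x (Z x))) -
      D.chr x (mvfderiv I D.emb x (Y x))
        (D.chr x (mvfderiv I D.emb x (X x)) (mvfderiv I D.emb x (Z x))) := by
  have := FiniteDimensional.complete ℝ E
  have hX1 := hX.mdifferentiableAt (by simp)
  have hY1 := hY.mdifferentiableAt (by simp)
  have hZ1 := hZ.mdifferentiableAt (by simp)
  have hc : MDifferentiableAt I 𝓘(ℝ, F →L[ℝ] F →L[ℝ] F) D.chr x :=
    (D.contMDiff_chr x).mdifferentiableAt (by simp)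
  have hz := contMDiffAt_mvfderiv_apply (D.contMDiff_emb x) hZ
  have step : ∀ X Y : VectField I M,
      ContMDiffAt I I.tangent ∞ (fun y ↦ (⟨y, X y⟩ : TangentBundle I M)) x →
      ContMDiffAt I I.tangent ∞ (fun y ↦ (⟨y, Y y⟩ : TangentBundle I M)) x →
      mvfderiv I D.emb x (D.cov (fun y ↦ D.cov Z y (Y y)) x (X x)) =
      mvfderiv I (fun y ↦ mvfderiv I (fun z ↦ mvfderiv I D.emb z (Z z)) y (Y y)) x (X x) +
      (mvfderiv I D.chr x (X x) (mvfderiv I D.emb x (Y x)) (mvfderiv I D.emb x (Z x)) +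
        D.chr x (mvfderiv I (fun y ↦ mvfderiv I D.emb y (Y y)) x (X x)) (mvfderiv I D.emb x (Z x)) +
        D.chr x (mvfderiv I D.emb x (Y x)) (mvfderiv I (fun y ↦ mvfderiv I D.emb y (Z y)) x (X x)))
      + (D.chr x (mvfderiv I D.emb x (X x))
          (mvfderiv I (fun y ↦ mvfderiv I D.emb y (Z y)) x (Y x)) +
        D.chr x (mvfderiv I D.emb x (X x))
          (D.chr x (mvfderiv I D.emb x (Y x)) (mvfderiv I D.emb x (Z x)))) := by
    intro X Y hX hY
    have hY1 := hY.mdifferentiableAt (by simp)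
    obtain ⟨h1, h2, h3⟩ := D.mdifferentiableAt_cov hY hZ
    rw [D.mvfderiv_emb_cov h3, h2.self_of_nhds]
    -- The formula for `∇_Y Z` is available only near `x`, where `Z` is differentiable; that
    -- suffices for the derivative at `x`.
    have h4 : mvfderiv I (fun y ↦ mvfderiv I D.emb y (D.cov Z y (Y y))) x =
        mvfderiv I ((fun y ↦ mvfderiv I (fun z ↦ mvfderiv I D.emb z (Z z)) y (Y y)) +
          fun y ↦ D.chr y (mvfderiv I D.emb y (Y y)) (mvfderiv I D.emb y (Z y))) x :=
      Filter.EventuallyEq.mfderiv_eq h2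
    have hcY := hc.clm_apply (D.mdifferentiableAt_image hY1)
    rw [h4, mvfderiv_add h1 (hcY.clm_apply (D.mdifferentiableAt_image hZ1)), add_apply,
      mvfderiv_clm_apply hcY (D.mdifferentiableAt_image hZ1),
      mvfderiv_clm_apply hc (D.mdifferentiableAt_image hY1), map_add]
    rfl
  unfold curvatureField
  rw [map_sub, map_sub, step X Y hX hY, step Y X hY hX, D.mvfderiv_emb_cov hZ1,
    mvfderiv_mlieBracket (hz.of_le (by norm_cast)) hX1 hY1,
    mvfderiv_mlieBracket ((D.contMDiff_emb x).of_le (by norm_cast)) hX1 hY1, map_sub]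
  simp only [sub_apply]
  abel

end ImmersedConnection

end Embedded
end PseudoRiemannian

/-! ### Linear algebra: rank and Jordan form of the curvature operators. -/

namespace CurvatureAlgebra

variable {V : Type*} [AddCommGroup V] [Module ℝ V]

/-- `T` maps `a` to `b` and `b` to `c • a`, and its range is spanned by `a` and `b`. -/
structure IsCyclicPair (T : V →ₗ[ℝ] V) (c : ℝ) (a b : V) : Prop where
  linearIndependent : LinearIndependent ℝ ![a, b]
  map_fst : T a = b
  map_snd : T b = c • a
  ne_zero : c ≠ 0
  range_le : ∀ z, ∃ α β : ℝ, T z = α • a + β • b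

namespace IsCyclicPair

variable {T T' : V →ₗ[ℝ] V} {c : ℝ} {a b a' b' : V}

/-- The coordinates `(α, β, k) ↦ α a + β b + k` with `k` in the kernel of `T`. -/
def coordMap (T : V →ₗ[ℝ] V) (a b : V) : (ℝ × ℝ) × LinearMap.ker T →ₗ[ℝ] V :=
  LinearMap.coprod (LinearMap.coprod (LinearMap.toSpanSingleton ℝ V a)
    (LinearMap.toSpanSingleton ℝ V b)) (LinearMap.ker T).subtype

theorem coordMap_apply (p : (ℝ × ℝ) × LinearMap.ker T) :
    coordMap T a b p = p.1.1 • a + p.1.2 • b + p.2 := by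
  simp [coordMap]

theorem map_coordMap (h : IsCyclicPair T c a b) (p : (ℝ × ℝ) × LinearMap.ker T) :
    T (coordMap T a b p) = coordMap T a b ((c * p.1.2, p.1.1), 0) := by
  have hk : T p.2 = 0 := p.2.2
  simp only [coordMap_apply, map_add, map_smul, h.map_fst, h.map_snd, hk, smul_smul]
  simp only [mul_comm p.1.2 c, ZeroMemClass.coe_zero]
  abel

/-- Since `c ≠ 0`, `T` restricts to an automorphism of the span of `a` and `b`, which contains its
range; hence this span is a complement of the kernel. -/
theorem bijective_coordMap (h : IsCyclicPair T c a b) :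
    Function.Bijective (coordMap T a b) := by
  have hli := LinearIndependent.pair_iff.1 h.linearIndependent
  constructor
  · rw [injective_iff_map_eq_zero]
    rintro ⟨⟨α, β⟩, k⟩ hp
    have h1 := h.map_coordMap ((α, β), k)
    rw [hp, map_zero, coordMap_apply] at h1
    obtain ⟨h2, h3⟩ := hli (c * β) α (by simpa using h1.symm)
    have h4 : β = 0 := (mul_eq_zero.1 h2).resolve_left h.ne_zero
    subst h3 h4
    rw [coordMap_apply] at hp
    simpa using hp
  · intro z
    obtain ⟨α, β, hz⟩ := h.range_le z
    have hk : z - (β • a + (α / c) • b) ∈ LinearMap.ker T := by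
      rw [LinearMap.mem_ker, map_sub, hz, map_add, map_smul, map_smul, h.map_fst, h.map_snd,
        smul_smul, div_mul_cancel₀ _ h.ne_zero]
      abel
    refine ⟨((β, α / c), ⟨_, hk⟩), ?_⟩
    rw [coordMap_apply]
    simp

/-- The coordinates of `V` given by a cyclic pair. -/
def coordEquiv (h : IsCyclicPair T c a b) : ((ℝ × ℝ) × LinearMap.ker T) ≃ₗ[ℝ] V :=
  LinearEquiv.ofBijective _ h.bijective_coordMap

theorem finrank_range [FiniteDimensional ℝ V] (h : IsCyclicPair T c a b) :
    Module.finrank ℝ (LinearMap.range T) = 2 := by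
  have h1 := h.coordEquiv.finrank_eq
  have h2 := LinearMap.finrank_range_add_finrank_ker T
  simp only [Module.finrank_prod, Module.finrank_self] at h1
  omega

/-- In the coordinates of a cyclic pair the operator is `(α, β, k) ↦ (c β, α, 0)`, which depends
only on `c` and on the dimension of the kernel; the latter is `dim V - 2`. -/
theorem jordanEquivalent [FiniteDimensional ℝ V] (h : IsCyclicPair T c a b)
    (h' : IsCyclicPair T' c a' b') : JordanEquivalent T T' := by
  have hk : Module.finrank ℝ (LinearMap.ker T') = Module.finrank ℝ (LinearMap.ker T) := by
    have h1 := LinearMap.finrank_range_add_finrank_ker T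
    have h2 := LinearMap.finrank_range_add_finrank_ker T'
    rw [h.finrank_range] at h1
    rw [h'.finrank_range] at h2
    omega
  let k := LinearEquiv.ofFinrankEq (LinearMap.ker T') (LinearMap.ker T) hk
  let Θ : V ≃ₗ[ℝ] V := h'.coordEquiv.symm ≪≫ₗ
    ((LinearEquiv.refl ℝ (ℝ × ℝ)).prodCongr k) ≪≫ₗ h.coordEquiv
  refine ⟨Θ, ?_⟩
  ext z
  obtain ⟨y, rfl⟩ := Θ.surjective z
  obtain ⟨p, rfl⟩ := h'.coordEquiv.surjective y
  simp only [LinearMap.comp_apply, LinearEquiv.coe_coe, LinearEquiv.symm_apply_apply]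
  have e1 : ∀ p, Θ (h'.coordEquiv p) = h.coordEquiv (p.1, k p.2) := by
    intro p
    simp [Θ]
  have e2 : T' (h'.coordEquiv p) = h'.coordEquiv ((c * p.1.2, p.1.1), 0) := h'.map_coordMap p
  have e3 : ∀ p, T (h.coordEquiv p) = h.coordEquiv ((c * p.1.2, p.1.1), 0) := h.map_coordMap
  rw [e2, e1, e1, e3]
  simp

end IsCyclicPair

section Planes

variable {g : V → V → ℝ}

theorem self_smul_add_smul (hs : ∀ u v, g u v = g v u)
    (hl : ∀ (a b : ℝ) (u v w : V), g (a • u + b • v) w = a * g u w + b * g v w)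
    (p q : ℝ) (e₁ e₂ : V) : g (p • e₁ + q • e₂) (p • e₁ + q • e₂) =
      p ^ 2 * g e₁ e₁ + 2 * p * q * g e₁ e₂ + q ^ 2 * g e₂ e₂ := by
  rw [hl, hs e₁ (p • e₁ + q • e₂), hs e₂ (p • e₁ + q • e₂), hl, hl, hs e₂ e₁]
  ring

/-- On the image of the plane under `φ`, `T` is skew and its square is minus `m²` times the Gram
determinant. A vector `w` of the plane that is not null makes `φ w` and its image independent; on
mixed planes null vectors would not do, as they can give eigenvectors. -/
theorem isCyclicPair_smul_rTensor (hs : ∀ u v, g u v = g v u)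
    (hl : ∀ (a b : ℝ) (u v w : V), g (a • u + b • v) w = a * g u w + b * g v w)
    {φ : V →ₗ[ℝ] V} (hφ : Function.Injective φ) (hiso : ∀ u v, g (φ u) (φ v) = g u v)
    {T : V →ₗ[ℝ] V} {e₁ e₂ : V} {m : ℝ} (hm : m ≠ 0) (hT : ∀ z, T z = m • RTensor g φ e₁ e₂ z)
    (hli : LinearIndependent ℝ ![e₁, e₂]) {p q : ℝ}
    (hw : g (p • e₁ + q • e₂) (p • e₁ + q • e₂) ≠ 0)
    (hD : g e₁ e₁ * g e₂ e₂ - g e₁ e₂ ^ 2 ≠ 0) :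
    IsCyclicPair T (-(m ^ 2 * (g e₁ e₁ * g e₂ e₂ - g e₁ e₂ ^ 2)))
      (φ (p • e₁ + q • e₂)) (T (φ (p • e₁ + q • e₂))) := by
  have hw' := self_smul_add_smul hs hl p q e₁ e₂
  have hT' : ∀ α β : ℝ, T (φ (α • e₁ + β • e₂)) =
      (m * (α * g e₁ e₂ + β * g e₂ e₂)) • φ e₁ - (m * (α * g e₁ e₁ + β * g e₁ e₂)) • φ e₂ := by
    intro α β
    rw [hT, RTensor, hiso, hiso, hs e₂, hs e₁, hl, hl, hs e₂ e₁]
    module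
  have hT1 : T (φ e₁) = (m * g e₁ e₂) • φ e₁ - (m * g e₁ e₁) • φ e₂ := by
    simpa using hT' 1 0
  have hT2 : T (φ e₂) = (m * g e₂ e₂) • φ e₁ - (m * g e₁ e₂) • φ e₂ := by
    simpa using hT' 0 1
  have hli' : ∀ s t : ℝ, s • φ e₁ + t • φ e₂ = 0 → s = 0 ∧ t = 0 := by
    intro s t hst
    rw [← map_smul, ← map_smul, ← map_add] at hst
    exact LinearIndependent.pair_iff.1 hli s t (hφ (by rw [hst, map_zero]))
  have hpq : φ (p • e₁ + q • e₂) = p • φ e₁ + q • φ e₂ := by simp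
  refine ⟨?_, rfl, ?_, neg_ne_zero.2 (mul_ne_zero (pow_ne_zero _ hm) hD), ?_⟩
  · rw [LinearIndependent.pair_iff]
    intro s t hst
    rw [hT', hpq] at hst
    obtain ⟨h1, h2⟩ := hli' (s * p + t * (m * (p * g e₁ e₂ + q * g e₂ e₂)))
      (s * q - t * (m * (p * g e₁ e₁ + q * g e₁ e₂))) (by rw [← hst]; module)
    -- Eliminating `s` from the two coordinate equations leaves `t` times the determinant, up to
    -- sign.
    have ht : t * (m * g (p • e₁ + q • e₂) (p • e₁ + q • e₂)) = 0 := by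
      rw [hw']
      linear_combination q * h1 - p * h2
    have ht0 : t = 0 := (mul_eq_zero.1 ht).resolve_right (mul_ne_zero hm hw)
    subst ht0
    refine ⟨?_, rfl⟩
    have h1' : s * p = 0 := by simpa using h1
    have h2' : s * q = 0 := by simpa using h2
    by_contra hs0
    have hp0 := (mul_eq_zero.1 h1').resolve_left hs0
    have hq0 := (mul_eq_zero.1 h2').resolve_left hs0
    rw [hw', hp0, hq0] at hw
    simp at hw
  · rw [hT', map_sub, map_smul, map_smul, hT1, hT2, hpq]
    module
  · intro z
    rw [hT', hpq, hT, RTensor]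
    set A := g (φ e₂) z
    set B := g (φ e₁) z
    set Q := g (p • e₁ + q • e₂) (p • e₁ + q • e₂)
    -- Cramer's rule for `m A φ e₁ - m B φ e₂` in the basis formed by the cyclic pair, whose
    -- determinant with respect to `φ e₁, φ e₂` is `-m Q`.
    refine ⟨m * (A * (p * g e₁ e₁ + q * g e₁ e₂) - B * (p * g e₁ e₂ + q * g e₂ e₂)) / Q,
      (A * q + B * p) / Q, ?_⟩
    have h1 : m * A =
        m * (A * (p * g e₁ e₁ + q * g e₁ e₂) - B * (p * g e₁ e₂ + q * g e₂ e₂)) / Q * p +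
        (A * q + B * p) / Q * (m * (p * g e₁ e₂ + q * g e₂ e₂)) := by
      field_simp
      rw [hw']
      ring
    have h2 : m * B =
        - (m * (A * (p * g e₁ e₁ + q * g e₁ e₂) - B * (p * g e₁ e₂ + q * g e₂ e₂)) / Q * q) +
        (A * q + B * p) / Q * (m * (p * g e₁ e₁ + q * g e₁ e₂)) := by
      field_simp
      rw [hw']
      ring
    rw [smul_sub, smul_smul, smul_smul, h1, h2]
    module

theorem isRankJordanIP_of_rTensor [FiniteDimensional ℝ V] (hs : ∀ u v, g u v = g v u)
    (hl : ∀ (a b : ℝ) (u v w : V), g (a • u + b • v) w = a * g u w + b * g v w)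
    {φ : V →ₗ[ℝ] V} (hφ : Function.Injective φ) (hiso : ∀ u v, g (φ u) (φ v) = g u v)
    {R : V → V → V →ₗ[ℝ] V} {C : ℝ} (hC : C ≠ 0) (hR : ∀ u v w, R u v w = C • RTensor g φ u v w)
    {P : V → V → Prop} (σ : ℝ)
    (hP : ∀ e₁ e₂, P e₁ e₂ → LinearIndependent ℝ ![e₁, e₂] ∧
      (∃ v ∈ Submodule.span ℝ {e₁, e₂}, g v v ≠ 0) ∧
      g e₁ e₁ * g e₂ e₂ - g e₁ e₂ ^ 2 ≠ 0 ∧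
      g e₁ e₁ * g e₂ e₂ - g e₁ e₂ ^ 2 = σ * |g e₁ e₁ * g e₂ e₂ - g e₁ e₂ ^ 2|) :
    IsRankJordanIP g P 2 R := by
  have key : ∀ e₁ e₂, P e₁ e₂ → ∃ a b,
      IsCyclicPair (skewCurvatureOperator g R e₁ e₂) (-(C ^ 2 * σ)) a b := by
    intro e₁ e₂ he
    obtain ⟨hli, ⟨v, hv, hgv⟩, hD, hσ⟩ := hP e₁ e₂ he
    obtain ⟨p, q, rfl⟩ := Submodule.mem_span_pair.1 hv
    have hN : √|g e₁ e₁ * g e₂ e₂ - g e₁ e₂ ^ 2| ≠ 0 :=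
      (Real.sqrt_pos.2 (abs_pos.2 hD)).ne'
    have h1 := isCyclicPair_smul_rTensor hs hl hφ hiso (T := skewCurvatureOperator g R e₁ e₂)
      (m := (√|g e₁ e₁ * g e₂ e₂ - g e₁ e₂ ^ 2|)⁻¹ * C) (mul_ne_zero (inv_ne_zero hN) hC)
      (fun z ↦ by rw [skewCurvatureOperator, LinearMap.smul_apply, hR, smul_smul]) hli hgv hD
    -- The normalization of `R(π)` removes the size of the Gram determinant and leaves its sign `σ`,
    -- so the cyclic constant is the same for all planes of the class.
    have h2 : ((√|g e₁ e₁ * g e₂ e₂ - g e₁ e₂ ^ 2|)⁻¹ * C) ^ 2 *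
        (g e₁ e₁ * g e₂ e₂ - g e₁ e₂ ^ 2) = C ^ 2 * σ := by
      rw [mul_pow, inv_pow, Real.sq_sqrt (abs_nonneg _)]
      have := abs_ne_zero.2 hD
      nth_rewrite 2 [hσ]
      field_simp
    rw [h2] at h1
    exact ⟨_, _, h1⟩
  refine ⟨fun e₁ e₂ he ↦ ?_, fun e₁ e₂ e₁' e₂' he he' ↦ ?_⟩
  · obtain ⟨a, b, h⟩ := key e₁ e₂ he
    exact h.finrank_range
  · obtain ⟨a, b, h⟩ := key e₁ e₂ he
    obtain ⟨a', b', h'⟩ := key e₁' e₂' he'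
    exact h.jordanEquivalent h'

variable {e₁ e₂ : V}

/-- The factor `s` treats both definite cases at once: it is `1` for spacelike and `-1` for timelike
planes. -/
theorem isRankJordanIP_definite_aux (hs : ∀ u v, g u v = g v u)
    (hl : ∀ (a b : ℝ) (u v w : V), g (a • u + b • v) w = a * g u w + b * g v w)
    (hli : LinearIndependent ℝ ![e₁, e₂]) {s : ℝ}
    (h : ∀ v ∈ Submodule.span ℝ {e₁, e₂}, v ≠ 0 → 0 < s * g v v) :
    (∃ v ∈ Submodule.span ℝ {e₁, e₂}, g v v ≠ 0) ∧
      0 < g e₁ e₁ * g e₂ e₂ - g e₁ e₂ ^ 2 := by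
  have h1 := h e₁ (Submodule.subset_span (by simp)) (hli.ne_zero 0)
  have h11 : g e₁ e₁ ≠ 0 := fun h0 ↦ by simp [h0] at h1
  refine ⟨⟨e₁, Submodule.subset_span (by simp), h11⟩, ?_⟩
  -- A Gram-Schmidt vector, orthogonal to `e₁`; its square is `g e₁ e₁` times the Gram determinant.
  have h2 := h ((-g e₁ e₂) • e₁ + g e₁ e₁ • e₂) (Submodule.mem_span_pair.2 ⟨_, _, rfl⟩)
    (fun h0 ↦ h11 (LinearIndependent.pair_iff.1 hli _ _ h0).2)
  rw [self_smul_add_smul hs hl] at h2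
  have h3 : s * ((-g e₁ e₂) ^ 2 * g e₁ e₁ + 2 * (-g e₁ e₂) * g e₁ e₁ * g e₁ e₂ +
      g e₁ e₁ ^ 2 * g e₂ e₂) = (s * g e₁ e₁) * (g e₁ e₁ * g e₂ e₂ - g e₁ e₂ ^ 2) := by ring
  rw [h3] at h2
  exact (mul_pos_iff_of_pos_left h1).1 h2

/-- If the Gram determinant were nonnegative, completing the square would make `g e₁ e₁` times the
quadratic form nonnegative, so the form could not take both signs. If `g e₁ e₁ = 0`, then `g e₁ e₂ =
0` too and only a multiple of `q²` is left. -/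
theorem MixedPlane.gram_neg (hs : ∀ u v, g u v = g v u)
    (hl : ∀ (a b : ℝ) (u v w : V), g (a • u + b • v) w = a * g u w + b * g v w)
    (h : MixedPlane g e₁ e₂) : g e₁ e₁ * g e₂ e₂ - g e₁ e₂ ^ 2 < 0 := by
  obtain ⟨-, ⟨u, hu, hgu⟩, ⟨v, hv, hgv⟩⟩ := h
  obtain ⟨p, q, rfl⟩ := Submodule.mem_span_pair.1 hu
  obtain ⟨p', q', rfl⟩ := Submodule.mem_span_pair.1 hv
  rw [self_smul_add_smul hs hl] at hgu hgv
  set a := g e₁ e₁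
  set b := g e₁ e₂
  set c := g e₂ e₂
  by_contra! hD
  have hsq : ∀ p q : ℝ, 0 ≤ a * (p ^ 2 * a + 2 * p * q * b + q ^ 2 * c) := by
    intro p q
    have : a * (p ^ 2 * a + 2 * p * q * b + q ^ 2 * c) =
      (p * a + q * b) ^ 2 + q ^ 2 * (a * c - b ^ 2) := by ring
    rw [this]
    positivity
  rcases lt_trichotomy a 0 with ha | ha | ha
  · exact absurd (hsq p' q') (not_le.2 (mul_neg_of_neg_of_pos ha hgv))
  · have hb : b = 0 := by
      rw [ha] at hD
      nlinarith [sq_nonneg b]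
    simp only [ha, hb, mul_zero, zero_add] at hgu hgv
    have h1 : c < 0 := neg_of_mul_neg_right hgu (sq_nonneg q)
    exact absurd hgv (not_lt.2 (mul_nonpos_of_nonneg_of_nonpos (sq_nonneg q') h1.le))
  · exact absurd (hsq p q) (not_le.2 (mul_neg_of_pos_of_neg ha hgu))

theorem isRankJordanIP_planes [FiniteDimensional ℝ V] (hs : ∀ u v, g u v = g v u)
    (hl : ∀ (a b : ℝ) (u v w : V), g (a • u + b • v) w = a * g u w + b * g v w)
    {φ : V →ₗ[ℝ] V} (hφ : Function.Injective φ) (hiso : ∀ u v, g (φ u) (φ v) = g u v)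
    {R : V → V → V →ₗ[ℝ] V} {C : ℝ} (hC : C ≠ 0)
    (hR : ∀ u v w, R u v w = C • RTensor g φ u v w) :
    IsRankJordanIP g (SpacelikePlane g) 2 R ∧ IsRankJordanIP g (TimelikePlane g) 2 R ∧
      IsRankJordanIP g (MixedPlane g) 2 R := by
  refine ⟨isRankJordanIP_of_rTensor hs hl hφ hiso hC hR 1 fun e₁ e₂ he ↦ ?_,
    isRankJordanIP_of_rTensor hs hl hφ hiso hC hR 1 fun e₁ e₂ he ↦ ?_,
    isRankJordanIP_of_rTensor hs hl hφ hiso hC hR (-1) fun e₁ e₂ he ↦ ?_⟩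
  · obtain ⟨h1, h2⟩ := isRankJordanIP_definite_aux (s := 1) hs hl he.1 (by simpa using he.2)
    exact ⟨he.1, h1, h2.ne', by rw [abs_of_pos h2, one_mul]⟩
  · obtain ⟨h1, h2⟩ := isRankJordanIP_definite_aux (s := -1) hs hl he.1 (by simpa using he.2)
    exact ⟨he.1, h1, h2.ne', by rw [abs_of_pos h2, one_mul]⟩
  · have h2 := he.gram_neg hs hl
    obtain ⟨v, hv, hgv⟩ := he.2.2
    exact ⟨he.1, ⟨v, hv, hgv.ne'⟩, h2.ne, by rw [abs_of_neg h2]; ring⟩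

end Planes

/-- The tensor `C R_φ` as a trilinear map. -/
def rTensorLinear {V : Type*} [AddCommGroup V] [Module ℝ V] (g : V →ₗ[ℝ] V →ₗ[ℝ] ℝ)
    (φ : V →ₗ[ℝ] V) (C : ℝ) : V →ₗ[ℝ] V →ₗ[ℝ] V →ₗ[ℝ] V :=
  LinearMap.mk₂ ℝ (fun u v ↦ C • ((g (φ v)).smulRight (φ u) - (g (φ u)).smulRight (φ v)))
    (fun u u' v ↦ by ext w; simp; module) (fun c u v ↦ by ext w; simp; module)
    (fun u v v' ↦ by ext w; simp; module) (fun c u v ↦ by ext w; simp; module)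

end CurvatureAlgebra

open PseudoRiemannian

theorem PseudoRiemannian.mvfderiv_comp_hasFDerivAt {E H M : Type*}
    [NormedAddCommGroup E] [NormedSpace ℝ E]
    [TopologicalSpace H] {I : ModelWithCorners ℝ E H} [TopologicalSpace M] [ChartedSpace H M]
    {F F' : Type*} [NormedAddCommGroup F] [NormedSpace ℝ F] [NormedAddCommGroup F']
    [NormedSpace ℝ F'] {Φ : F → F'} {Φ' : F →L[ℝ] F'} {h : M → F} {x : M}
    (hΦ : HasFDerivAt Φ Φ' (h x)) (hh : MDifferentiableAt I 𝓘(ℝ, F) h x) (u : TangentSpace I x) :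
    mvfderiv I (fun y ↦ Φ (h y)) x u = Φ' (mvfderiv I h x u) := by
  refine (mfderiv_comp_apply (f := h) x hΦ.differentiableAt.mdifferentiableAt hh u).trans ?_
  rw [mfderiv_eq_fderiv, hΦ.fderiv]
  rfl

theorem mvfderiv_opens_coe {J : TopologicalSpace.Opens ℝ} (t : J) (a : TangentSpace 𝓘(ℝ, ℝ) t) :
    mvfderiv 𝓘(ℝ, ℝ) (fun y : J ↦ (y : ℝ)) t a = a := by
  have h : MDifferentiableAt 𝓘(ℝ, ℝ) 𝓘(ℝ, ℝ) (fun y : J ↦ (y : ℝ)) t :=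
    (contMDiff_subtype_val (n := 1) t).mdifferentiableAt (by simp)
  have h1 : ∀ y, extChartAt 𝓘(ℝ, ℝ) t y = (y : ℝ) := fun y ↦ rfl
  have h2 : writtenInExtChartAt 𝓘(ℝ, ℝ) 𝓘(ℝ, ℝ) t (fun y : J ↦ (y : ℝ)) =ᶠ[
      𝓝 (extChartAt 𝓘(ℝ, ℝ) t t)] id := by
    filter_upwards [extChartAt_target_mem_nhds (I := 𝓘(ℝ, ℝ)) t] with e he
    exact (h1 _).symm.trans ((extChartAt 𝓘(ℝ, ℝ) t).right_inv he)
  rw [h.mvfderiv, ModelWithCorners.range_eq_univ, fderivWithin_univ, h2.fderiv_eq, fderiv_id]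
  rfl

/-! ### The tangent spaces of the pseudo-sphere inside the ambient space. -/

namespace PseudoSphere

variable {r s : ℕ} {δ : ℤˣ} {ϱ : ℝ} [Fact (0 < ϱ)]

theorem contDiffAt_lift (p : pseudosphere r s δ ϱ) {y : EuclideanSpace ℝ (Fin (r + s - 1))}
    (hy : y ∈ (chart p).target) : ContDiffAt ℝ ∞ (lift p) y := by
  have hw : ContDiff ℝ ∞ (fun y ↦ ((perpEquiv p).symm y : Ambient r s)) :=
    ((perp (p : Ambient r s)).subtypeL.comp
      (perpEquiv p).symm.toContinuousLinearMap).contDiff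
  have hh : ContDiffAt ℝ ∞ (fun y ↦ height p ((perpEquiv p).symm y : Ambient r s)) y := by
    unfold height
    refine ContDiffAt.sqrt (by fun_prop) ?_
    exact ne_of_gt (show 0 < 1 - (form r s p p)⁻¹ *
      form r s ((perpEquiv p).symm y : Ambient r s) ((perpEquiv p).symm y) from hy)
  exact (hh.smul contDiffAt_const).add hw.contDiffAt

theorem coe_chart_symm (p : pseudosphere r s δ ϱ) {y : EuclideanSpace ℝ (Fin (r + s - 1))}
    (hy : y ∈ (chart p).target) : ((chart p).symm y : Ambient r s) = lift p y := by
  exact congrArg Subtype.val (dif_pos (lift_mem p y hy))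

theorem chart_self (p : pseudosphere r s δ ϱ) : chart p p = 0 := by
  change perpEquiv p (perpProj p p) = 0
  have : perpProj p (p : Ambient r s) = 0 := by
    apply Subtype.ext
    rw [perpProj_coe, inv_mul_cancel₀ (form_self_ne_zero p)]
    simp
  rw [this, map_zero]

theorem zero_mem_chart_target (p : pseudosphere r s δ ϱ) : 0 ∈ (chart p).target := by
  rw [← chart_self p]
  exact (chart p).map_source (mem_chart_source _ p)

theorem writtenInExtChartAt_coe (p : pseudosphere r s δ ϱ) :
    writtenInExtChartAt 𝓘(ℝ, EuclideanSpace ℝ (Fin (r + s - 1))) 𝓘(ℝ, Ambient r s) p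
      (fun v : pseudosphere r s δ ϱ ↦ (v : Ambient r s)) =ᶠ[𝓝 0] lift p := by
  filter_upwards [(chart p).open_target.mem_nhds (zero_mem_chart_target p)] with y hy
  exact coe_chart_symm p hy

theorem extChartAt_self (p : pseudosphere r s δ ϱ) :
    extChartAt 𝓘(ℝ, EuclideanSpace ℝ (Fin (r + s - 1))) p p = 0 :=
  chart_self p

theorem contMDiff_coe : ContMDiff 𝓘(ℝ, EuclideanSpace ℝ (Fin (r + s - 1))) 𝓘(ℝ, Ambient r s) ∞
    (fun v : pseudosphere r s δ ϱ ↦ (v : Ambient r s)) := by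
  intro p
  rw [contMDiffAt_iff]
  refine ⟨continuous_subtype_val.continuousAt, ?_⟩
  rw [ModelWithCorners.range_eq_univ, contDiffWithinAt_univ, extChartAt_self]
  exact (contDiffAt_lift p (zero_mem_chart_target p)).congr_of_eventuallyEq
    (writtenInExtChartAt_coe p)

/-- The height depends on `w` only through the quadratic `(w, w)`, so it is stationary at the origin
and only the linear term `w` contributes. -/
theorem hasFDerivAt_lift (p : pseudosphere r s δ ϱ) :
    HasFDerivAt (lift p) ((perp (p : Ambient r s)).subtypeL.comp
      (perpEquiv p).symm.toContinuousLinearMap) 0 := by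
  have hw : HasFDerivAt (fun y ↦ ((perpEquiv p).symm y : Ambient r s))
      ((perp (p : Ambient r s)).subtypeL.comp (perpEquiv p).symm.toContinuousLinearMap) 0 :=
    ((perp (p : Ambient r s)).subtypeL.comp
      (perpEquiv p).symm.toContinuousLinearMap).hasFDerivAt
  have hh : HasFDerivAt (fun y ↦ height p ((perpEquiv p).symm y : Ambient r s))
      (0 : EuclideanSpace ℝ (Fin (r + s - 1)) →L[ℝ] ℝ) 0 := by
    unfold height
    have h0 : HasFDerivAt (fun y ↦ form r s ((perpEquiv p).symm y : Ambient r s))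
        ((form r s).comp ((perp (p : Ambient r s)).subtypeL.comp
          (perpEquiv p).symm.toContinuousLinearMap)) 0 :=
      ((form r s).comp ((perp (p : Ambient r s)).subtypeL.comp
        (perpEquiv p).symm.toContinuousLinearMap)).hasFDerivAt
    have h1 := h0.clm_apply hw
    have h2 := ((h1.const_mul (form r s p p)⁻¹).const_sub 1).sqrt (by simp)
    refine h2.congr_fderiv ?_
    ext v
    simp
  have h := (hh.smul_const (p : Ambient r s)).add hw
  refine HasFDerivAt.congr_fderiv (f := lift p) h ?_
  ext v
  simp

theorem mvfderiv_coe (p : pseudosphere r s δ ϱ)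
    (v : TangentSpace 𝓘(ℝ, EuclideanSpace ℝ (Fin (r + s - 1))) p) :
    mvfderiv 𝓘(ℝ, EuclideanSpace ℝ (Fin (r + s - 1)))
      (fun v : pseudosphere r s δ ϱ ↦ (v : Ambient r s)) p v = (perpEquiv p).symm v := by
  rw [((contMDiff_coe p).mdifferentiableAt (by simp)).mvfderiv, ModelWithCorners.range_eq_univ,
    fderivWithin_univ, extChartAt_self, (writtenInExtChartAt_coe p).fderiv_eq,
    (hasFDerivAt_lift p).fderiv]
  rfl

/-- The form is nondegenerate on the orthogonal complement of a point of the pseudo-sphere. -/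
theorem form_nondegenerate (v : Ambient r s) (h : ∀ w, form r s v w = 0) : v = 0 := by
  ext i
  rcases i with i | j
  · have := h (Pi.single (Sum.inl i) 1)
    simpa [form_apply, Pi.single_apply] using this
  · have := h (Pi.single (Sum.inr j) 1)
    simpa [form_apply, Pi.single_apply] using this

/-- Every vector is the sum of its projection to the complement of `p` and a multiple of `p`, and
`v` is orthogonal to both. -/
theorem eq_zero_of_form_perp (p : pseudosphere r s δ ϱ) {v : Ambient r s} (hv : form r s p v = 0)
    (h : ∀ w : perp (p : Ambient r s), form r s v w = 0) : v = 0 := by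
  refine form_nondegenerate v fun w ↦ ?_
  have h1 := h (perpProj p w)
  rw [perpProj_coe, map_sub, map_smul, form_symm r s v p, hv] at h1
  simpa using h1

end PseudoSphere

/-! ### The warped product inside `ℝ × ℝ^{r+s}`: metric, connection, curvature. -/

namespace WarpedProduct

open PseudoSphere

variable {r s : ℕ} {δ : ℤˣ} {ϱ : ℝ} [Fact (0 < ϱ)] {J : TopologicalSpace.Opens ℝ}

theorem toSphere_apply (x : J × pseudosphere r s δ ϱ) (u : TangentSpace (model r s) x) :
    toSphere x u = u.2 := by
  unfold toSphere
  rw [mfderiv_snd]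
  rfl

theorem contMDiff_time : ContMDiff (model r s) 𝓘(ℝ, ℝ) ∞
    (fun y : J × pseudosphere r s δ ϱ ↦ (y.1 : ℝ)) :=
  contMDiff_subtype_val.comp contMDiff_fst

theorem contMDiff_space : ContMDiff (model r s) 𝓘(ℝ, Ambient r s) ∞
    (fun y : J × pseudosphere r s δ ϱ ↦ (y.2 : Ambient r s)) :=
  contMDiff_coe.comp contMDiff_snd

theorem dt_apply (x : J × pseudosphere r s δ ϱ) (u : TangentSpace (model r s) x) :
    dt x u = u.1 := by
  unfold dt
  have h : MDifferentiableAt 𝓘(ℝ, ℝ) 𝓘(ℝ, ℝ) (fun y : J ↦ (y : ℝ)) x.1 :=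
    (contMDiff_subtype_val (n := 1) x.1).mdifferentiableAt (by simp)
  refine (mfderiv_comp_apply (I := model r s) (f := Prod.fst) x h mdifferentiableAt_fst u).trans ?_
  rw [mfderiv_fst]
  exact mvfderiv_opens_coe _ _

theorem mvfderiv_space (x : J × pseudosphere r s δ ϱ) (u : TangentSpace (model r s) x) :
    mvfderiv (model r s) (fun y : J × pseudosphere r s δ ϱ ↦ (y.2 : Ambient r s)) x u =
      (perpEquiv x.2).symm u.2 := by
  have h := (contMDiff_coe x.2).mdifferentiableAt (by simp)
  refine (mfderiv_comp_apply (I := model r s) (f := Prod.snd) x h mdifferentiableAt_snd u).trans ?_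
  rw [mfderiv_snd]
  exact mvfderiv_coe _ _

/-- The inclusion of `J × S` into `ℝ × ℝ^{r+s}`. -/
def emb (x : J × pseudosphere r s δ ϱ) : ℝ × Ambient r s := (x.1, x.2)

theorem contMDiff_emb : ContMDiff (model r s) 𝓘(ℝ, ℝ × Ambient r s) ∞
    (emb : J × pseudosphere r s δ ϱ → ℝ × Ambient r s) :=
  contMDiff_time.prodMk_space contMDiff_space

theorem mvfderiv_prodMk {E H M : Type*} [NormedAddCommGroup E] [NormedSpace ℝ E]
    [TopologicalSpace H] {I : ModelWithCorners ℝ E H} [TopologicalSpace M] [ChartedSpace H M]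
    {F F' : Type*} [NormedAddCommGroup F] [NormedSpace ℝ F] [NormedAddCommGroup F']
    [NormedSpace ℝ F'] {a : M → F} {b : M → F'} {x : M}
    (ha : MDifferentiableAt I 𝓘(ℝ, F) a x) (hb : MDifferentiableAt I 𝓘(ℝ, F') b x)
    (u : TangentSpace I x) :
    mvfderiv I (fun y ↦ (a y, b y)) x u = (mvfderiv I a x u, mvfderiv I b x u) := by
  have h1 := ha.hasMFDerivAt.2.prodMk hb.hasMFDerivAt.2
  have h2 := h1.fderivWithin (I.uniqueDiffOn _ (Set.mem_range_self _))
  rw [(ha.prodMk_space hb).mvfderiv]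
  exact congrArg (fun T : E →L[ℝ] F × F' ↦ T u) h2

theorem mvfderiv_emb (x : J × pseudosphere r s δ ϱ) (u : TangentSpace (model r s) x) :
    mvfderiv (model r s) emb x u = (u.1, ((perpEquiv x.2).symm u.2 : Ambient r s)) := by
  refine (mvfderiv_prodMk ((contMDiff_time x).mdifferentiableAt (by simp))
    ((contMDiff_space x).mdifferentiableAt (by simp)) u).trans ?_
  rw [mvfderiv_space]
  exact congrArg (fun a : ℝ ↦ (a, ((perpEquiv x.2).symm u.2 : Ambient r s))) (dt_apply x u)

/-- This exhibits the metric as the pullback under `emb` of an ambient metric, so that all later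
computations take place in the vector space. -/
theorem metric_apply (ε : ℤˣ) (f : ℝ → ℝ) (x : J × pseudosphere r s δ ϱ)
    (u v : TangentSpace (model r s) x) :
    metric r s δ ϱ J ε f x u v = sgn ε * ((mvfderiv (model r s) emb x u).1 *
      (mvfderiv (model r s) emb x v).1) + f x.1 * form r s (mvfderiv (model r s) emb x u).2
        (mvfderiv (model r s) emb x v).2 := by
  rw [mvfderiv_emb, mvfderiv_emb]
  have h1 : metric r s δ ϱ J ε f x u v = sgn ε * (dt x u * dt x v) + f x.1 *
      form r s (mvfderiv 𝓘(ℝ, EuclideanSpace ℝ (Fin (r + s - 1)))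
        (fun v : pseudosphere r s δ ϱ ↦ (v : Ambient r s)) x.2 (toSphere x u))
        (mvfderiv 𝓘(ℝ, EuclideanSpace ℝ (Fin (r + s - 1)))
        (fun v : pseudosphere r s δ ϱ ↦ (v : Ambient r s)) x.2 (toSphere x v)) := rfl
  rw [h1, mvfderiv_coe, mvfderiv_coe, dt_apply, dt_apply, toSphere_apply, toSphere_apply]

section Ambient

section SMulConst

variable {E G : Type*} [NormedAddCommGroup E] [NormedSpace ℝ E] [NormedAddCommGroup G]
  [NormedSpace ℝ G] {c : E → ℝ} {x : E}

theorem contDiffAt_smul_const_right (h : ContDiffAt ℝ ∞ c x) (v : G) :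
    ContDiffAt ℝ ∞ (fun y ↦ c y • v) x := h.smul contDiffAt_const

theorem hasFDerivAt_smul_const_right {c' : E →L[ℝ] ℝ} (h : HasFDerivAt c c' x) (v : G) :
    HasFDerivAt (fun y ↦ c y • v) (c'.smulRight v) x := h.smul_const v

end SMulConst

variable {W : Type*} [NormedAddCommGroup W] [NormedSpace ℝ W]

/-- The trilinear map `(w, X, Y) ↦ q X Y • w`. -/
def formSMul (q : W →L[ℝ] W →L[ℝ] ℝ) : W →L[ℝ] W →L[ℝ] W →L[ℝ] W :=
  ((ContinuousLinearMap.compL ℝ W (W →L[ℝ] ℝ) (W →L[ℝ] W)).flip q).comp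
    (ContinuousLinearMap.smulRightL ℝ W W).flip

theorem formSMul_apply (q : W →L[ℝ] W →L[ℝ] ℝ) (w X Y : W) : formSMul q w X Y = q X Y • w := rfl

/-- The symmetric bilinear map `(X, Y) ↦ a X • n Y + a Y • n X`. -/
def mixedMul (a : W →L[ℝ] ℝ) (n : W →L[ℝ] W) : W →L[ℝ] W →L[ℝ] W :=
  a.smulRight n + (a.smulRight n).flip

theorem mixedMul_apply (a : W →L[ℝ] ℝ) (n : W →L[ℝ] W) (X Y : W) :
    mixedMul a n X Y = a X • n Y + a Y • n X := by
  simp [mixedMul]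

variable (a : W →L[ℝ] ℝ) (n : W →L[ℝ] W) (d : W) (q : W →L[ℝ] W →L[ℝ] ℝ)
  (e : ℝ) (f f₁ : ℝ → ℝ) (κ₀ : ℝ)

/-- The metric `e a² + f(a) q` of a vector space with linear coordinate `a`. -/
def ambientMetric (P : W) : W →L[ℝ] W →L[ℝ] ℝ :=
  e • a.smulRight a + f (a P) • q

/-- The Christoffel tensor of the warped product, as a function on the ambient space. -/
def ambientChr (P : W) : W →L[ℝ] W →L[ℝ] W :=
  formSMul q ((-(e * f₁ (a P) / 2)) • d + κ₀ • n P) + (f₁ (a P) / (2 * f (a P))) • mixedMul a n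

theorem ambientChr_apply (P X Y : W) :
    ambientChr a n d q e f f₁ κ₀ P X Y =
      q X Y • ((-(e * f₁ (a P) / 2)) • d + κ₀ • n P) +
        (f₁ (a P) / (2 * f (a P))) • (a X • n Y + a Y • n X) := by
  rw [ambientChr, add_apply, add_apply, smul_apply, smul_apply, formSMul_apply, mixedMul_apply]

variable {a n d q e f f₁ κ₀}

theorem contDiff_ambientMetric (hf : ContDiff ℝ ∞ f) : ContDiff ℝ ∞ (ambientMetric a q e f) :=
  contDiff_const.add (contDiff_iff_contDiffAt.2 fun _ ↦
    contDiffAt_smul_const_right (hf.comp a.contDiff).contDiffAt q)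

theorem contDiffAt_ambientChr (hf : ContDiff ℝ ∞ f) (hf₁ : ContDiff ℝ ∞ f₁) {P : W}
    (hP : f (a P) ≠ 0) : ContDiffAt ℝ ∞ (ambientChr a n d q e f f₁ κ₀) P := by
  have h1 : ContDiffAt ℝ ∞ (fun P ↦ f₁ (a P) / (2 * f (a P))) P :=
    ContDiffAt.div (by fun_prop) (by fun_prop) (by simpa using hP)
  have h3 : ContDiffAt ℝ ∞
      (fun P ↦ formSMul q ((-(e * f₁ (a P) / 2)) • d + κ₀ • n P)) P := by fun_prop
  have h4 : ContDiffAt ℝ ∞ (fun P ↦ (f₁ (a P) / (2 * f (a P))) • mixedMul a n) P :=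
    contDiffAt_smul_const_right h1 (mixedMul a n)
  exact h3.add h4

theorem hasFDerivAt_ambientMetric {P : W} {m : ℝ} (hf : HasDerivAt f m (a P)) :
    HasFDerivAt (ambientMetric a q e f) ((m • a).smulRight q) P := by
  have h1 : HasFDerivAt (fun P ↦ f (a P)) (m • a) P := hf.comp_hasFDerivAt P a.hasFDerivAt
  exact (hasFDerivAt_smul_const_right h1 q).const_add _

theorem hasFDerivAt_ambientChr {P : W} {m l : ℝ}
    (hf₁ : HasDerivAt f₁ m (a P)) (hq : HasDerivAt (fun t ↦ f₁ t / (2 * f t)) l (a P)) :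
    HasFDerivAt (ambientChr a n d q e f f₁ κ₀)
      ((formSMul q).comp (((-(e * m / 2)) • a).smulRight d + κ₀ • n) +
        (l • a).smulRight (mixedMul a n)) P := by
  have h1 : HasFDerivAt (fun P ↦ -(e * f₁ (a P) / 2)) ((-(e * m / 2)) • a) P :=
    (((hf₁.const_mul e).div_const 2).neg).comp_hasFDerivAt P a.hasFDerivAt
  have h2 : HasFDerivAt (fun P ↦ f₁ (a P) / (2 * f (a P))) (l • a) P :=
    hq.comp_hasFDerivAt P a.hasFDerivAt
  have h3 : HasFDerivAt (fun P ↦ κ₀ • n P) (κ₀ • n) P := n.hasFDerivAt.const_smul κ₀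
  exact ((formSMul q).hasFDerivAt.comp P ((hasFDerivAt_smul_const_right h1 d).add h3)).add
    (hasFDerivAt_smul_const_right h2 (mixedMul a n))

end Ambient

section Product

variable (r s : ℕ)

/-- The time coordinate of `ℝ × ℝ^{r+s}`. -/
def timeCoord : ℝ × Ambient r s →L[ℝ] ℝ := ContinuousLinearMap.fst ℝ ℝ (Ambient r s)

/-- The projection `(a, v) ↦ (0, v)` of `ℝ × ℝ^{r+s}`. -/
def spaceProj : ℝ × Ambient r s →L[ℝ] ℝ × Ambient r s :=
  (ContinuousLinearMap.inr ℝ ℝ (Ambient r s)).comp (ContinuousLinearMap.snd ℝ ℝ (Ambient r s))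

/-- The bilinear form `((a, v), (b, w)) ↦ (v, w)` on `ℝ × ℝ^{r+s}`. -/
def spaceForm : ℝ × Ambient r s →L[ℝ] ℝ × Ambient r s →L[ℝ] ℝ :=
  pullback (form r s) (ContinuousLinearMap.snd ℝ ℝ (Ambient r s))

variable (ε : ℤˣ) (f f₁ : ℝ → ℝ) (κ₀ : ℝ)

/-- The metric `ε dt² + f(t) (·, ·)` of `ℝ × ℝ^{r+s}`. -/
def productMetric : ℝ × Ambient r s → ℝ × Ambient r s →L[ℝ] ℝ × Ambient r s →L[ℝ] ℝ :=
  ambientMetric (timeCoord r s) (spaceForm r s) (sgn ε) f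

/-- The Christoffel tensor of the warped product, as a function on `ℝ × ℝ^{r+s}`. -/
def productChr : ℝ × Ambient r s →
    ℝ × Ambient r s →L[ℝ] ℝ × Ambient r s →L[ℝ] ℝ × Ambient r s :=
  ambientChr (timeCoord r s) (spaceProj r s) (1, 0) (spaceForm r s) (sgn ε) f f₁ κ₀

theorem productMetric_apply (P X Y : ℝ × Ambient r s) :
    productMetric r s ε f P X Y = sgn ε * (X.1 * Y.1) + f P.1 * form r s X.2 Y.2 := rfl

theorem productChr_apply (P X Y : ℝ × Ambient r s) :
    productChr r s ε f f₁ κ₀ P X Y =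
      (form r s X.2 Y.2 * -(sgn ε * f₁ P.1 / 2),
        form r s X.2 Y.2 • κ₀ • P.2 + (f₁ P.1 / (2 * f P.1)) • (X.1 • Y.2 + Y.1 • X.2)) := by
  rw [productChr, ambientChr_apply]
  ext <;> simp [timeCoord, spaceProj, spaceForm, pullback]

theorem productChr_symm (P X Y : ℝ × Ambient r s) :
    productChr r s ε f f₁ κ₀ P X Y = productChr r s ε f f₁ κ₀ P Y X := by
  rw [productChr_apply, productChr_apply, form_symm r s X.2, add_comm (X.1 • Y.2)]

end Product

theorem form_mvfderiv_emb (x : J × pseudosphere r s δ ϱ) (u : TangentSpace (model r s) x) :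
    form r s x.2 (mvfderiv (model r s) emb x u).2 = 0 := by
  rw [mvfderiv_emb]
  exact form_perp x.2 _

/-- Differentiating the constraint `(p, Z) = 0` along `u` gives the normal component of `D_u Z`. -/
theorem form_mvfderiv_mvfderiv_emb {x : J × pseudosphere r s δ ϱ}
    {Z : VectField (model r s) (J × pseudosphere r s δ ϱ)}
    (hZ : MDifferentiableAt (model r s) (model r s).tangent
      (fun y ↦ (⟨y, Z y⟩ : TangentBundle (model r s) (J × pseudosphere r s δ ϱ))) x)
    (u : TangentSpace (model r s) x) :
    form r s x.2 (mvfderiv (model r s) (fun y ↦ mvfderiv (model r s) emb y (Z y)) x u).2 =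
      - form r s (mvfderiv (model r s) emb x u).2 (mvfderiv (model r s) emb x (Z x)).2 := by
  have hz : MDifferentiableAt (model r s) 𝓘(ℝ, ℝ × Ambient r s)
      (fun y : J × pseudosphere r s δ ϱ ↦ mvfderiv (model r s) emb y (Z y)) x :=
    mdifferentiableAt_mvfderiv_apply ((contMDiff_emb x).of_le (by norm_cast)) hZ
  have he : MDifferentiableAt (model r s) 𝓘(ℝ, ℝ × Ambient r s)
      (emb : J × pseudosphere r s δ ϱ → _) x := (contMDiff_emb x).mdifferentiableAt (by simp)
  have hΦ := (spaceForm r s).hasFDerivAt (x := emb x)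
  have hA : MDifferentiableAt (model r s) 𝓘(ℝ, ℝ × Ambient r s →L[ℝ] ℝ)
      (fun y : J × pseudosphere r s δ ϱ ↦ spaceForm r s (emb y)) x :=
    hΦ.differentiableAt.comp_mdifferentiableAt he
  have h1 := mvfderiv_clm_apply hA hz u
  have h2 : (fun y : J × pseudosphere r s δ ϱ ↦
      spaceForm r s (emb y) (mvfderiv (model r s) emb y (Z y))) = fun _ ↦ 0 :=
    funext fun y ↦ form_mvfderiv_emb y (Z y)
  rw [h2, mvfderiv_const, mvfderiv_comp_hasFDerivAt hΦ he] at h1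
  exact eq_neg_of_add_eq_zero_right h1.symm

/-- The left inverse of the derivative of `emb` given by orthogonal projection. -/
def retr (x : J × pseudosphere r s δ ϱ) : ℝ × Ambient r s →L[ℝ] TangentSpace (model r s) x :=
  (ContinuousLinearMap.fst ℝ ℝ (Ambient r s)).prod
    (((perpEquiv x.2).toContinuousLinearMap.comp (perpProj x.2)).comp
      (ContinuousLinearMap.snd ℝ ℝ (Ambient r s)))

theorem mvfderiv_emb_retr (x : J × pseudosphere r s δ ϱ) {w : ℝ × Ambient r s}
    (hw : form r s x.2 w.2 = 0) : mvfderiv (model r s) emb x (retr x w) = w := by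
  rw [mvfderiv_emb]
  change (w.1, ((perpEquiv x.2).symm (perpEquiv x.2 (perpProj x.2 w.2)) : Ambient r s)) = w
  rw [ContinuousLinearEquiv.symm_apply_apply, perpProj_coe, hw]
  simp

theorem mvfderiv_emb_injective (x : J × pseudosphere r s δ ϱ) :
    Function.Injective (mvfderiv (model r s) emb x) := by
  intro u v h
  rw [mvfderiv_emb, mvfderiv_emb, Prod.mk.injEq] at h
  exact Prod.ext h.1 ((perpEquiv x.2).symm.injective (Subtype.ext h.2))

variable {ε : ℤˣ} {f f₁ : ℝ → ℝ} {κ₀ : ℝ}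

/-- The connection of the warped product. -/
def connection (J : TopologicalSpace.Opens ℝ) (ε : ℤˣ) (hf : ContDiff ℝ ∞ f)
    (hf₁ : ContDiff ℝ ∞ f₁) (hfJ : ∀ t ∈ J, f t ≠ 0)
    (hκ₀ : ∀ p : pseudosphere r s δ ϱ, κ₀ * form r s p p = 1) :
    ImmersedConnection (model r s) (J × pseudosphere r s δ ϱ) (ℝ × Ambient r s) where
  emb := emb
  retr := retr
  chr x := productChr r s ε f f₁ κ₀ (emb x)
  contMDiff_emb := contMDiff_emb
  contMDiff_chr := fun x ↦ ContMDiffAt.comp (g := productChr r s ε f f₁ κ₀) x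
    (contDiffAt_ambientChr hf hf₁ (hfJ x.1 x.1.2)).contMDiffAt (contMDiff_emb x)
  retr_mvfderiv x v := mvfderiv_emb_injective x (mvfderiv_emb_retr x (form_mvfderiv_emb x v))
  tangent x Z hZ u := by
    -- It suffices that the vector is orthogonal to `p`. The derivative contributes `-(x, z)`, the
    -- term along `p` contributes `κ₀ (p, p) (x, z) = (x, z)`, and the mixed terms are tangent.
    apply mvfderiv_emb_retr
    rw [Prod.snd_add, map_add, form_mvfderiv_mvfderiv_emb hZ, productChr_apply]
    have h1 := form_mvfderiv_emb x u
    have h2 := form_mvfderiv_emb x (Z x)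
    have h3 := hκ₀ x.2
    simp only [map_add, map_smul, h1, h2, smul_eq_mul]
    change -_ + (_ * (κ₀ * form r s x.2 x.2) + _) = (0 : ℝ)
    rw [h3]
    ring

theorem isMetric_metric (hf : ContDiff ℝ ∞ f) (hfJ : ∀ t ∈ J, f t ≠ 0) :
    IsMetric (model r s) (metric r s δ ϱ J ε f) where
  smooth := by
    refine contMDiff_formField (G := fun x ↦ productMetric r s ε f (emb x)) contMDiff_emb ?_
      fun x u v ↦ metric_apply ε f x u v
    exact (contDiff_ambientMetric hf).contMDiff.comp contMDiff_emb
  symm x u v := by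
    rw [metric_apply, metric_apply, form_symm, mul_comm (mvfderiv (model r s) emb x u).1]
  nondegenerate x u hu := by
    apply mvfderiv_emb_injective x
    rw [map_zero]
    have hε : sgn ε ≠ 0 := Int.cast_ne_zero.2 ε.ne_zero
    ext1
    · have h := hu (retr x (1, 0))
      rw [metric_apply, mvfderiv_emb_retr x (by simp)] at h
      simpa [hε] using h
    · refine eq_zero_of_form_perp x.2 (form_mvfderiv_emb x u) fun w ↦ ?_
      have h := hu (retr x (0, w))
      rw [metric_apply, mvfderiv_emb_retr x (form_perp x.2 w)] at h
      simpa [hfJ x.1 x.1.2] using h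

/-- The term along `p` is orthogonal to tangent vectors. The `dt`-terms of the two factors give `f'
dt(u) (v, w)`, the derivative of the metric; the remaining mixed terms cancel against the time
components because `ε² = 1`. -/
theorem isLeviCivita_connection (hf : ContDiff ℝ ∞ f) (hf₁ : ContDiff ℝ ∞ f₁)
    (hfJ : ∀ t ∈ J, f t ≠ 0) (hκ₀ : ∀ p : pseudosphere r s δ ϱ, κ₀ * form r s p p = 1)
    (hd : ∀ t, HasDerivAt f (f₁ t) t) :
    IsLeviCivita (model r s) (metric r s δ ϱ J ε f) (connection J ε hf hf₁ hfJ hκ₀).cov := by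
  refine (connection J ε hf hf₁ hfJ hκ₀).isLeviCivita
    (G := fun x ↦ productMetric r s ε f (emb x)) (fun x u v ↦ productChr_symm ..)
    ((contDiff_ambientMetric hf).contMDiff.comp contMDiff_emb)
    (fun x u v ↦ metric_apply ε f x u v) fun x u v w ↦ ?_
  change mvfderiv (model r s) (fun x ↦ productMetric r s ε f (emb x)) x u
      (mvfderiv (model r s) emb x v) (mvfderiv (model r s) emb x w) =
    productMetric r s ε f (emb x) (productChr r s ε f f₁ κ₀ (emb x)
      (mvfderiv (model r s) emb x u) (mvfderiv (model r s) emb x v))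
      (mvfderiv (model r s) emb x w) +
    productMetric r s ε f (emb x) (mvfderiv (model r s) emb x v)
      (productChr r s ε f f₁ κ₀ (emb x)
      (mvfderiv (model r s) emb x u) (mvfderiv (model r s) emb x w))
  rw [mvfderiv_comp_hasFDerivAt (hasFDerivAt_ambientMetric (hd _))
    ((contMDiff_emb x).mdifferentiableAt (by simp))]
  have h2 : form r s (emb x).2 (mvfderiv (model r s) emb x v).2 = 0 := form_mvfderiv_emb x v
  have h3 : form r s (emb x).2 (mvfderiv (model r s) emb x w).2 = 0 := form_mvfderiv_emb x w
  have h4 := h2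
  rw [form_symm] at h4
  have hft : f (emb x).1 ≠ 0 := hfJ x.1 x.1.2
  generalize mvfderiv (model r s) emb x u = U at *
  generalize mvfderiv (model r s) emb x v = V at *
  generalize mvfderiv (model r s) emb x w = W at *
  rw [productMetric_apply, productMetric_apply, productChr_apply, productChr_apply]
  simp only [map_add, map_smul, add_apply, smul_apply, ContinuousLinearMap.smulRight_apply, h3, h4,
    smul_eq_mul]
  change f₁ (emb x).1 * U.1 * form r s V.2 W.2 = _
  rw [form_symm r s V.2 U.2]
  have hε : sgn ε * sgn ε = 1 := by
    rcases Int.units_eq_one_or ε with h | h <;> simp [sgn, h]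
  field_simp
  linear_combination (f₁ (emb x).1 * (form r s U.2 V.2 * W.1 + form r s U.2 W.2 * V.1)) * hε

open CurvatureAlgebra

theorem mvfderiv_productChr {r s : ℕ} {δ : ℤˣ} {ϱ : ℝ} [Fact (0 < ϱ)]
    {J : TopologicalSpace.Opens ℝ} {ε : ℤˣ} {f f₁ : ℝ → ℝ} {κ₀ m l : ℝ}
    (x : J × pseudosphere r s δ ϱ) (hf₁ : HasDerivAt f₁ m x.1)
    (hq : HasDerivAt (fun t ↦ f₁ t / (2 * f t)) l x.1) (u : TangentSpace (model r s) x)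
    (Y Z : ℝ × Ambient r s) :
    mvfderiv (model r s) (fun y ↦ productChr r s ε f f₁ κ₀ (emb y)) x u Y Z =
      (form r s Y.2 Z.2 * -(sgn ε * m / 2 * (mvfderiv (model r s) emb x u).1),
        form r s Y.2 Z.2 • κ₀ • (mvfderiv (model r s) emb x u).2 +
          (l * (mvfderiv (model r s) emb x u).1) • (Y.1 • Z.2 + Z.1 • Y.2)) := by
  rw [mvfderiv_comp_hasFDerivAt (hasFDerivAt_ambientChr (P := emb x) hf₁ hq)
    ((contMDiff_emb x).mdifferentiableAt (by simp))]
  generalize mvfderiv (model r s) emb x u = U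
  rw [add_apply, ContinuousLinearMap.comp_apply, add_apply, add_apply,
    formSMul_apply, ContinuousLinearMap.smulRight_apply, smul_apply, smul_apply, mixedMul_apply]
  ext <;> simp [timeCoord, spaceProj, spaceForm, pullback]

/-- The complement of `p` has dimension at most one, so `x` and `y` are multiples of a single
vector. This is why `κ` is free in low dimensions. -/
theorem smul_sub_smul_eq_zero {r s : ℕ} {δ : ℤˣ} {ϱ : ℝ} [Fact (0 < ϱ)] (hrs : r + s < 3)
    {p : pseudosphere r s δ ϱ} {x y : Ambient r s} (hx : form r s p x = 0)
    (hy : form r s p y = 0) (z : Ambient r s) :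
    form r s y z • x - form r s x z • y = 0 := by
  have h1 : Module.finrank ℝ (perp (p : Ambient r s)) ≤ 1 := by
    rw [finrank_perp, finrank_euclideanSpace_fin]
    omega
  obtain ⟨v, hv⟩ := finrank_le_one_iff.1 h1
  obtain ⟨a, ha⟩ := hv ⟨x, hx⟩
  obtain ⟨b, hb⟩ := hv ⟨y, hy⟩
  obtain rfl : a • (v : Ambient r s) = x := congrArg Subtype.val ha
  obtain rfl : b • (v : Ambient r s) = y := congrArg Subtype.val hb
  simp only [map_smul, smul_apply, smul_smul, smul_eq_mul]
  rw [mul_right_comm, mul_right_comm a, mul_comm a b, sub_self]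

/-- The Gauss equation of the warped product: the curvature formula of its Christoffel tensor. -/
theorem productChr_curvature {r s : ℕ} {ε : ℤˣ} {f f₁ : ℝ → ℝ} {κ κ₀ C t l : ℝ}
    {p x y z : Ambient r s} (hx : form r s p x = 0) (hy : form r s p y = 0)
    (a b c : ℝ) (hf : f t ≠ 0)
    (hl : l = (2 * sgn ε * κ * f t - f₁ t ^ 2) / (2 * f t ^ 2))
    (hC : C = (f t ^ 2)⁻¹ * (f t * κ - 1 / 4 * sgn ε * f₁ t ^ 2))
    (h0 : (κ₀ - κ) • (form r s y z • x - form r s x z • y) = 0) :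
    ((form r s y z * -(sgn ε * (2 * sgn ε * κ) / 2 * a),
        form r s y z • κ₀ • x + (l * a) • (b • z + c • y)) : ℝ × Ambient r s) -
      (form r s x z * -(sgn ε * (2 * sgn ε * κ) / 2 * b),
        form r s x z • κ₀ • y + (l * b) • (a • z + c • x)) +
      productChr r s ε f f₁ κ₀ (t, p) (a, x) (productChr r s ε f f₁ κ₀ (t, p) (b, y) (c, z)) -
      productChr r s ε f f₁ κ₀ (t, p) (b, y) (productChr r s ε f f₁ κ₀ (t, p) (a, x) (c, z)) =
    C • ((sgn ε * (b * c) + f t * form r s (-y) z) • (a, -x) -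
      (sgn ε * (a * c) + f t * form r s (-x) z) • (b, -y)) := by
  have hε : sgn ε = 1 ∨ sgn ε = -1 := by
    rcases Int.units_eq_one_or ε with h | h <;> simp [sgn, h]
  have hx' : form r s x p = 0 := by rw [form_symm, hx]
  have hy' : form r s y p = 0 := by rw [form_symm, hy]
  simp only [productChr_apply]
  subst hC hl
  generalize sgn ε = e at *
  ext i
  · simp only [Prod.fst_sub, Prod.fst_add, Prod.smul_fst, map_add, map_smul, map_neg, neg_apply,
      smul_eq_mul, hx', hy']
    rw [form_symm r s y x]
    rcases hε with rfl | rfl <;> field_simp <;> ring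
  · have h1 := congrFun h0 i
    simp only [Prod.snd_sub, Prod.snd_add, Prod.smul_snd, map_add, map_smul, map_neg, neg_apply,
      smul_eq_mul, hx', hy', Pi.add_apply, Pi.sub_apply, Pi.smul_apply, Pi.neg_apply,
      Pi.zero_apply] at h1 ⊢
    -- With this symmetry the terms along `p` from the two iterated Christoffel products agree and
    -- cancel. The hypothesis `h0` then trades `κ₀` for `κ`.
    rw [form_symm r s y x]
    linear_combination (norm := skip) h1
    rcases hε with rfl | rfl <;> field_simp <;> ring

theorem mvfderiv_emb_phi (x : J × pseudosphere r s δ ϱ) (u : TangentSpace (model r s) x) :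
    mvfderiv (model r s) emb x (phi x u) =
      ((mvfderiv (model r s) emb x u).1, -(mvfderiv (model r s) emb x u).2) := by
  rw [mvfderiv_emb, mvfderiv_emb]
  change (u.1, ((perpEquiv x.2).symm (-u.2) : Ambient r s)) = _
  rw [map_neg]
  rfl

theorem phi_injective (x : J × pseudosphere r s δ ϱ) : Function.Injective (phi x) := by
  intro u v h
  have h1 := congrArg (mvfderiv (model r s) emb x) h
  rw [mvfderiv_emb_phi, mvfderiv_emb_phi, Prod.mk.injEq, neg_inj] at h1
  exact mvfderiv_emb_injective x (Prod.ext h1.1 h1.2)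

theorem metric_phi_phi (ε : ℤˣ) (f : ℝ → ℝ) (x : J × pseudosphere r s δ ϱ)
    (u v : TangentSpace (model r s) x) :
    metric r s δ ϱ J ε f x (phi x u) (phi x v) = metric r s δ ϱ J ε f x u v := by
  rw [metric_apply, metric_apply, mvfderiv_emb_phi, mvfderiv_emb_phi]
  simp

theorem curvatureField_connection {ε : ℤˣ} {f f₁ : ℝ → ℝ} {κ κ₀ C : ℝ} (hf : ContDiff ℝ ∞ f)
    (hf₁ : ContDiff ℝ ∞ f₁) (hfJ : ∀ t ∈ J, f t ≠ 0)
    (hκ₀ : ∀ p : pseudosphere r s δ ϱ, κ₀ * form r s p p = 1) (hκ : 3 ≤ r + s → κ = κ₀)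
    (x : J × pseudosphere r s δ ϱ) (hd : HasDerivAt f (f₁ x.1) x.1)
    (hd₁ : HasDerivAt f₁ (2 * sgn ε * κ) x.1)
    (hC : C = (f x.1 ^ 2)⁻¹ * (f x.1 * κ - 1 / 4 * sgn ε * f₁ x.1 ^ 2))
    {X Y Z : VectField (model r s) (J × pseudosphere r s δ ϱ)}
    (hX : ContMDiffAt (model r s) (model r s).tangent ∞
      (fun y ↦ (⟨y, X y⟩ : TangentBundle (model r s) (J × pseudosphere r s δ ϱ))) x)
    (hY : ContMDiffAt (model r s) (model r s).tangent ∞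
      (fun y ↦ (⟨y, Y y⟩ : TangentBundle (model r s) (J × pseudosphere r s δ ϱ))) x)
    (hZ : ContMDiffAt (model r s) (model r s).tangent ∞
      (fun y ↦ (⟨y, Z y⟩ : TangentBundle (model r s) (J × pseudosphere r s δ ϱ))) x) :
    curvatureField (model r s) (connection J ε hf hf₁ hfJ hκ₀).cov X Y Z x =
      C • RTensor (fun u v ↦ metric r s δ ϱ J ε f x u v) (phi x) (X x) (Y x) (Z x) := by
  have hft := hfJ x.1 x.1.2
  apply mvfderiv_emb_injective x
  refine ((connection J ε hf hf₁ hfJ hκ₀).mvfderiv_emb_curvatureField hX hY hZ).trans ?_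
  change mvfderiv (model r s) (fun y ↦ productChr r s ε f f₁ κ₀ (emb y)) x (X x)
      (mvfderiv (model r s) emb x (Y x)) (mvfderiv (model r s) emb x (Z x)) -
    mvfderiv (model r s) (fun y ↦ productChr r s ε f f₁ κ₀ (emb y)) x (Y x)
      (mvfderiv (model r s) emb x (X x)) (mvfderiv (model r s) emb x (Z x)) +
    productChr r s ε f f₁ κ₀ (emb x) (mvfderiv (model r s) emb x (X x))
      (productChr r s ε f f₁ κ₀ (emb x) (mvfderiv (model r s) emb x (Y x))
        (mvfderiv (model r s) emb x (Z x))) -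
    productChr r s ε f f₁ κ₀ (emb x) (mvfderiv (model r s) emb x (Y x))
      (productChr r s ε f f₁ κ₀ (emb x) (mvfderiv (model r s) emb x (X x))
        (mvfderiv (model r s) emb x (Z x))) = _
  -- The derivative of `f'/(2f)`; the condition `f'' = 2εκ` enters here and through `hd₁`.
  have hq := hd₁.div (hd.const_mul 2) (by simpa using hft)
  rw [mvfderiv_productChr x hd₁ hq, mvfderiv_productChr x hd₁ hq]
  simp only [RTensor, map_smul, map_sub, mvfderiv_emb_phi, metric_apply]
  have hx := form_mvfderiv_emb x (X x)
  have hy := form_mvfderiv_emb x (Y x)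
  refine productChr_curvature (κ := κ) hx hy _ _ _ hft ?_ hC ?_
  · field_simp
  · by_cases hrs : 3 ≤ r + s
    · rw [hκ hrs, sub_self, zero_smul]
    · rw [smul_sub_smul_eq_zero (by omega) hx hy, smul_zero]

end WarpedProduct

end

/-! ### The theorem. -/

theorem lemma3p3 (r s : ℕ) (ϱ : ℝ) [Fact (0 < ϱ)] (ε δ : ℤˣ) (κ A B : ℝ)
    (hκ : 3 ≤ r + s → κ = ((δ : ℤ) : ℝ) * ϱ ^ 2)
    (hAB : A ^ 2 - 4 * ((ε : ℤ) : ℝ) * κ * B ≠ 0)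
    (f : ℝ → ℝ) (hf : ∀ t, f t = ((ε : ℤ) : ℝ) * κ * t ^ 2 + A * t + B)
    (J : TopologicalSpace.Opens ℝ) (hJ : (J : Set ℝ).OrdConnected)
    (hfJ : ∀ t ∈ J, f t ≠ 0)
    (C : ℝ → ℝ)
    (hC : ∀ t, C t = (f t ^ 2)⁻¹ * (f t * κ - 1 / 4 * ((ε : ℤ) : ℝ) * deriv f t ^ 2)) :
    PseudoRiemannian.IsMetric (WarpedProduct.model r s)
      (WarpedProduct.metric r s δ ϱ J ε f) ∧
    (∃ R : PseudoRiemannian.CurvField (WarpedProduct.model r s)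
        (J × PseudoSphere.pseudosphere r s δ ϱ),
      PseudoRiemannian.IsRiemannCurvature (WarpedProduct.model r s)
        (WarpedProduct.metric r s δ ϱ J ε f) R ∧
      ∀ (x : J × PseudoSphere.pseudosphere r s δ ϱ)
        (u v w : TangentSpace (WarpedProduct.model r s) x),
        R x u v w = C x.1 • CurvatureAlgebra.RTensor
          (fun a b ↦ WarpedProduct.metric r s δ ϱ J ε f x a b) (WarpedProduct.phi x) u v w) ∧
    PseudoRiemannian.IsSpacelikeRankJordanIP (WarpedProduct.model r s)
      (WarpedProduct.metric r s δ ϱ J ε f) 2 ∧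
    PseudoRiemannian.IsTimelikeRankJordanIP (WarpedProduct.model r s)
      (WarpedProduct.metric r s δ ϱ J ε f) 2 ∧
    PseudoRiemannian.IsMixedRankJordanIP (WarpedProduct.model r s)
      (WarpedProduct.metric r s δ ϱ J ε f) 2 := by
  obtain rfl : f = fun t ↦ ((ε : ℤ) : ℝ) * κ * t ^ 2 + A * t + B := funext hf
  set f : ℝ → ℝ := fun t ↦ ((ε : ℤ) : ℝ) * κ * t ^ 2 + A * t + B with hfdef
  set f₁ : ℝ → ℝ := fun t ↦ 2 * ((ε : ℤ) : ℝ) * κ * t + A with hf₁def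
  have hd : ∀ t, HasDerivAt f (f₁ t) t := fun t ↦ by
    refine ((((hasDerivAt_pow 2 t).const_mul (((ε : ℤ) : ℝ) * κ)).add
      ((hasDerivAt_id t).const_mul A)).add_const B).congr_deriv ?_
    simp [hf₁def]
    ring
  have hd₁ : ∀ t, HasDerivAt f₁ (2 * ((ε : ℤ) : ℝ) * κ) t := fun t ↦
    (((hasDerivAt_id t).const_mul (2 * ((ε : ℤ) : ℝ) * κ)).add_const A).congr_deriv
      (mul_one _)
  have hsf : ContDiff ℝ ∞ f := by fun_prop
  have hsf₁ : ContDiff ℝ ∞ f₁ := by fun_prop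
  have hC₁ : ∀ t, C t = (f t ^ 2)⁻¹ * (f t * κ - 1 / 4 * ((ε : ℤ) : ℝ) * f₁ t ^ 2) := fun t ↦ by
    rw [hC t, (hd t).deriv]
  -- The `t`-dependence of `f κ - ε f'²/4` cancels, leaving `-ε/4` times the discriminant of `f`.
  have hC0 : ∀ t ∈ J, C t ≠ 0 := fun t ht ↦ by
    rw [hC₁ t]
    refine mul_ne_zero (inv_ne_zero (pow_ne_zero 2 (hfJ t ht))) fun h ↦ hAB ?_
    rcases Int.units_eq_one_or ε with rfl | rfl <;>
      simp only [hfdef, hf₁def, Units.val_one, Units.val_neg, Int.cast_one, Int.cast_neg] at h ⊢ <;>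
      linarith
  -- The connection uses `κ₀ = δ ϱ²` in every dimension, even where `κ` is a different number.
  have hκ₀ : ∀ p : PseudoSphere.pseudosphere r s δ ϱ,
      ((δ : ℤ) : ℝ) * ϱ ^ 2 * PseudoSphere.form r s p p = 1 := fun p ↦ by
    have hϱ : 0 < ϱ := Fact.out
    rw [show PseudoSphere.form r s p p = ((δ : ℤ) : ℝ) * (ϱ ^ 2)⁻¹ from p.2]
    rcases Int.units_eq_one_or δ with rfl | rfl <;> simp <;> field_simp
  have hM := WarpedProduct.isMetric_metric (r := r) (s := s) (δ := δ) (ϱ := ϱ) (ε := ε) hsf hfJ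
  have hLC := WarpedProduct.isLeviCivita_connection (ε := ε) hsf hsf₁ hfJ hκ₀ hd
  let R : PseudoRiemannian.CurvField (WarpedProduct.model r s)
      (J × PseudoSphere.pseudosphere r s δ ϱ) := fun x ↦
    CurvatureAlgebra.rTensorLinear
      (ContinuousLinearMap.coeLM ℝ ∘ₗ (WarpedProduct.metric r s δ ϱ J ε f x).toLinearMap)
      (WarpedProduct.phi x) (C x.1)
  have hR : ∀ (x : J × PseudoSphere.pseudosphere r s δ ϱ)
      (u v w : TangentSpace (WarpedProduct.model r s) x),
      R x u v w = C x.1 • CurvatureAlgebra.RTensor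
        (fun a b ↦ WarpedProduct.metric r s δ ϱ J ε f x a b) (WarpedProduct.phi x) u v w :=
    fun x u v w ↦ rfl
  have hcurv : PseudoRiemannian.IsRiemannCurvature (WarpedProduct.model r s)
      (WarpedProduct.metric r s δ ϱ J ε f) R := by
    refine PseudoRiemannian.isRiemannCurvature_of_isLeviCivita hM.symm hM.nondegenerate hLC
      (fun x Y Z hY hZ ↦ ((WarpedProduct.connection J ε hsf hsf₁ hfJ hκ₀).mdifferentiableAt_cov
        hY hZ).2.2) fun x X Y Z hX hY hZ ↦ ?_
    rw [hR]
    exact WarpedProduct.curvatureField_connection hsf hsf₁ hfJ hκ₀ hκ x (hd _) (hd₁ _) (hC₁ _)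
      hX hY hZ
  have hIP := fun x : J × PseudoSphere.pseudosphere r s δ ϱ ↦
    have : FiniteDimensional ℝ (TangentSpace (WarpedProduct.model r s) x) :=
      inferInstanceAs (FiniteDimensional ℝ (ℝ × EuclideanSpace ℝ (Fin (r + s - 1))))
    CurvatureAlgebra.isRankJordanIP_planes
      (g := fun u v ↦ WarpedProduct.metric r s δ ϱ J ε f x u v) (R := fun u v ↦ R x u v)
      (hM.symm x) (fun a b u v w ↦ by simp) (WarpedProduct.phi_injective x)
      (WarpedProduct.metric_phi_phi ε f x) (hC0 x.1 x.1.2) (hR x)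
  exact ⟨hM, ⟨R, hcurv, hR⟩, ⟨R, hcurv, fun x ↦ (hIP x).1⟩, ⟨R, hcurv, fun x ↦ (hIP x).2.1⟩,
    ⟨R, hcurv, fun x ↦ (hIP x).2.2⟩⟩
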